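/- Let $Q>0$, $N>0$ and $P\ge 0$. Consider real random variables $X_0,W_1,W_2,U_1,X_1,Y_1$ whose joint law decomposes as $\mathcal P_{X_0}\mathcal P_{W_1}\mathcal P_{W_2|X_0,W_1}\mathcal P_{U_1|X_0,W_1}\mathcal P_{X_1,Y_1|X_0,U_1}$, where $X_0\sim\mathcal N(0,Q)$, $X_1=X_0+U_1$ and $Y_1=X_1+Z_1$ with $Z_1\sim\mathcal N(0,N)$ independent of $(X_0,W_1,W_2,U_1)$, and put $U_2=\mathbb E[X_1\mid W_1,W_2,Y_1]$. Define $$S_{\mathsf G}(P)=\inf\ \mathbb E\big[(X_1-\mathbb E[X_1\mid W_1,W_2,Y_1])^2\big],$$ where the infimum is over all such choices of $\mathcal P_{W_1},\mathcal P_{W_2|X_0,W_1},\mathcal P_{U_1|X_0,W_1}$ for which $(X_0,W_1,W_2,U_1,X_1,Y_1,U_2)$ is jointly Gaussian (possibly degenerate), $\mathbb E[U_1^2]=P$, and $I(W_1,W_2;Y_1)-I(W_2;X_0\mid W_1)\ge 0$. Then the set over which the infimum is taken is non-empty and $$S_{\mathsf G}(P)=\begin{cases}\dfrac{N(Q-N-P)}{Q}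 & \text{if } Q>4N \text{ and } P\in[P_1,P_2],\\[2mm] S_\ell(P)&\text{otherwise,}\end{cases}$$ where $P_1=\tfrac12\big(Q-2N-\sqrt{Q^2-4QN}\big)$, $P_2=\tfrac12\big(Q-2N+\sqrt{Q^2-4QN}\big)$, and $S_\ell$ is the best linear cost $$S_\ell(P)=\begin{cases}\dfrac{(\sqrt Q-\sqrt P)^2N}{(\sqrt Q-\sqrt P)^2+N}&\text{if }P\in[0,Q],\\[2mm]0&\text{otherwise.}\end{cases}$$ -/

import Mathlib

open MeasureTheory ProbabilityTheory InformationTheory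
open scoped ENNReal

noncomputable section

namespace Witsenhausen

/-- Mutual information `I(X; Y) = D(P_{XY} ‖ P_X ⊗ P_Y)`, with values in `[0, ∞]`. -/
def mutualInfo {Ω α β : Type*} [MeasurableSpace Ω] [MeasurableSpace α] [MeasurableSpace β]
    (μ : Measure Ω) (X : Ω → α) (Y : Ω → β) : ℝ≥0∞ :=
  klDiv (μ.map (fun ω ↦ (X ω, Y ω))) ((μ.map X).prod (μ.map Y))

/-- Conditional mutual information `I(X; Y | Z) = D(P_{ZXY} ‖ P_Z ⊗ (P_{X|Z} × P_{Y|Z}))`,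
with values in `[0, ∞]`. -/
def condMutualInfo {Ω α β γ : Type*} [MeasurableSpace Ω]
    [MeasurableSpace α] [StandardBorelSpace α] [Nonempty α]
    [MeasurableSpace β] [StandardBorelSpace β] [Nonempty β] [MeasurableSpace γ]
    (μ : Measure Ω) [IsFiniteMeasure μ] (X : Ω → α) (Y : Ω → β) (Z : Ω → γ) : ℝ≥0∞ :=
  klDiv (μ.map (fun ω ↦ (Z ω, X ω, Y ω)))
    (μ.map Z ⊗ₘ (condDistrib X Z μ ×ₖ condDistrib Y Z μ))

/-- The joint law of the real random variables `(X₀, W₁, W₂, U₁, X₁, Y₁)` decomposes as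
`P_{X₀} P_{W₁} P_{W₂|X₀,W₁} P_{U₁|X₀,W₁} P_{X₁,Y₁|X₀,U₁}`, where `P_{X₀} = N(0, Q)` and where
`P_{X₁,Y₁|X₀,U₁}` is the channel `X₁ = X₀ + U₁`, `Y₁ = X₁ + Z₁` with noise `Z₁ ∼ N(0, N)`. -/
structure IsSystem (Q N : ℝ) {Ω : Type} [MeasurableSpace Ω] [StandardBorelSpace Ω]
    (μ : Measure Ω) [IsProbabilityMeasure μ] (X₀ W₁ W₂ U₁ X₁ Y₁ : Ω → ℝ) : Prop where
  measurable_X₀ : Measurable X₀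
  measurable_W₁ : Measurable W₁
  measurable_W₂ : Measurable W₂
  measurable_U₁ : Measurable U₁
  measurable_X₁ : Measurable X₁
  measurable_Y₁ : Measurable Y₁
  /-- the source -/
  law_X₀ : HasLaw X₀ (gaussianReal 0 Q.toNNReal) μ
  /-- `X₀` and `W₁` are independent -/
  indep_X₀_W₁ : X₀ ⟂ᵢ[μ] W₁
  /-- the Markov chain `U₁ - (X₀, W₁) - W₂` -/
  condIndep_U₁_W₂ : U₁ ⟂ᵢ[fun ω ↦ (X₀ ω, W₁ ω), measurable_X₀.prodMk measurable_W₁; μ] W₂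
  /-- the interim state -/
  X₁_eq : ∀ ω, X₁ ω = X₀ ω + U₁ ω
  /-- the law of the channel noise `Z₁ = Y₁ - X₁` -/
  law_noise : HasLaw (fun ω ↦ Y₁ ω - X₁ ω) (gaussianReal 0 N.toNNReal) μ
  /-- the channel noise is independent of everything that precedes the channel -/
  indep_noise : (fun ω ↦ Y₁ ω - X₁ ω) ⟂ᵢ[μ] (fun ω ↦ (X₀ ω, W₁ ω, W₂ ω, U₁ ω))

/-- The MMSE decision `U₂ = E[X₁ | W₁, W₂, Y₁]`. -/
def mmse {Ω : Type} [mΩ : MeasurableSpace Ω] (μ : Measure Ω) (W₁ W₂ X₁ Y₁ : Ω → ℝ) : Ω → ℝ :=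
  μ[X₁ | MeasurableSpace.comap (fun ω ↦ (W₁ ω, W₂ ω, Y₁ ω)) inferInstance]

/-- The estimation costs `E[(X₁ - E[X₁ | W₁, W₂, Y₁])²]` of all jointly Gaussian (possibly
degenerate, possibly non-centred) choices with power cost `E[U₁²] = P` that satisfy the information
constraint `I(W₁, W₂; Y₁) - I(W₂; X₀ | W₁) ≥ 0`. The first of these two terms is always finite
(`Y₁` carries an independent Gaussian noise and has finite variance), so that the comparison in
`[0, ∞]` is the constraint on the difference also when the second term is infinite. -/
def gaussianCosts (Q N P : ℝ) : Set ℝ :=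
  {S | ∃ (Ω : Type) (_ : MeasurableSpace Ω) (_ : StandardBorelSpace Ω)
      (μ : Measure Ω) (_ : IsProbabilityMeasure μ) (X₀ W₁ W₂ U₁ X₁ Y₁ : Ω → ℝ),
      IsSystem Q N μ X₀ W₁ W₂ U₁ X₁ Y₁ ∧
      HasGaussianLaw (fun ω ↦ (X₀ ω, W₁ ω, W₂ ω, U₁ ω, X₁ ω, Y₁ ω, mmse μ W₁ W₂ X₁ Y₁ ω)) μ ∧
      ∫ ω, U₁ ω ^ 2 ∂μ = P ∧
      condMutualInfo μ W₂ X₀ W₁ ≤ mutualInfo μ (fun ω ↦ (W₁ ω, W₂ ω)) Y₁ ∧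
      ∫ ω, (X₁ ω - mmse μ W₁ W₂ X₁ Y₁ ω) ^ 2 ∂μ = S}

/-- The optimal estimation cost `S_G(P)` under the joint Gaussian restriction. -/
def gaussianOptimalCost (Q N P : ℝ) : ℝ := sInf (gaussianCosts Q N P)

/-- The best linear cost `S_ℓ(P)`. -/
def linearCost (Q N P : ℝ) : ℝ :=
  if P ∈ Set.Icc 0 Q then (√Q - √P) ^ 2 * N / ((√Q - √P) ^ 2 + N) else 0

/-- The left end point `P₁`. -/
def P₁ (Q N : ℝ) : ℝ := 1 / 2 * (Q - 2 * N - √(Q ^ 2 - 4 * Q * N))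

/-- The right end point `P₂`. -/
def P₂ (Q N : ℝ) : ℝ := 1 / 2 * (Q - 2 * N + √(Q ^ 2 - 4 * Q * N))

end Witsenhausen

end

/-! Regression reduces the problem to four real parameters. Write U₁ = aX₀ + bW₁ + V and X₀ = αW₁ +
βW₂ + D with residuals V and D; the Markov chain makes V uncorrelated with W₂ as well. Let σ, v be
the variances of D, V and B = b² Var W₁. Given W₁, W₂ the state X₁ has variance τ = (1+a)²σ + v, so
the cost is τN/(τ+N), increasing in τ. Since X₀ is independent of W₁, I(W₂;X₀|W₁) = I(W₁,W₂;X₀) = ½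
log(Q/σ), and the information constraint collapses to Q(v+N) ≤ σ(B+v+N). The power cost gives a²Q +
B + v ≤ P. This is `exists_of_mem_gaussianCosts`.

With K = B+v+N these constraints give (τ+N)K ≥ N((1+a)²Q+K) and a²Q+K ≤ N+P. Completing a square
gives the affine lower bound `tangent_le_cost`, whose equality case a = -(N+P)/Q is affordable
exactly when (N+P)² ≤ PQ, that is, on [P₁, P₂]. If instead PQ ≤ (N+P)² and P ≤ Q, it is best to
spend all power on a = -√(P/Q) (`linear_le_cost`); for P > Q, a = -1 gives cost 0. Every value is
attained by `mem_gaussianCosts`, with v = 0 and the information constraint tight. -/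

namespace Witsenhausen

/-! ### Mutual information and the additive Gaussian channel -/

lemma klDiv_map_measurableEquiv {α β : Type*} [MeasurableSpace α] [MeasurableSpace β]
    (μ ν : Measure α) [IsFiniteMeasure μ] [IsFiniteMeasure ν] (e : α ≃ᵐ β) :
    klDiv (μ.map e) (ν.map e) = klDiv μ ν := by
  refine le_antisymm (klDiv_map_le μ ν e.measurable) ?_
  simpa [Measure.map_map e.symm.measurable e.measurable] using
    klDiv_map_le (μ.map e) (ν.map e) e.symm.measurable

lemma condDistrib_ae_eq_const_of_indepFun {Ω β γ : Type*} [MeasurableSpace Ω]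
    [MeasurableSpace β] [StandardBorelSpace β] [Nonempty β] [MeasurableSpace γ]
    {μ : Measure Ω} [IsProbabilityMeasure μ] {Y : Ω → β} {Z : Ω → γ}
    (hY : Measurable Y) (hZ : Measurable Z) (h : Y ⟂ᵢ[μ] Z) :
    condDistrib Y Z μ =ᵐ[μ.map Z] Kernel.const γ (μ.map Y) := by
  have := Measure.isProbabilityMeasure_map (μ := μ) hY.aemeasurable
  rw [condDistrib_ae_eq_iff_measure_eq_compProd _ hY.aemeasurable, Measure.compProd_const]
  exact (indepFun_iff_map_prod_eq_prod_map_map hZ.aemeasurable hY.aemeasurable).1 h.symm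

/-- If `Y` is independent of `Z`, then `I(X; Y | Z) = I((Z, X); Y)`. -/
lemma condMutualInfo_eq_mutualInfo_of_indepFun {Ω α β γ : Type*} [MeasurableSpace Ω]
    [MeasurableSpace α] [StandardBorelSpace α] [Nonempty α]
    [MeasurableSpace β] [StandardBorelSpace β] [Nonempty β] [MeasurableSpace γ]
    {μ : Measure Ω} [IsProbabilityMeasure μ] {X : Ω → α} {Y : Ω → β} {Z : Ω → γ}
    (hX : Measurable X) (hY : Measurable Y) (hZ : Measurable Z) (h : Y ⟂ᵢ[μ] Z) :
    condMutualInfo μ X Y Z = mutualInfo μ (fun ω ↦ (Z ω, X ω)) Y := by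
  have := Measure.isProbabilityMeasure_map (μ := μ) hY.aemeasurable
  have := Measure.isProbabilityMeasure_map (μ := μ) hZ.aemeasurable
  have := Measure.isProbabilityMeasure_map (μ := μ) (hZ.prodMk hX).aemeasurable
  have := Measure.isProbabilityMeasure_map (μ := μ) (hZ.prodMk (hX.prodMk hY)).aemeasurable
  have hker : condDistrib X Z μ ×ₖ condDistrib Y Z μ
      =ᵐ[μ.map Z] condDistrib X Z μ ×ₖ Kernel.const γ (μ.map Y) := by
    filter_upwards [condDistrib_ae_eq_const_of_indepFun hY hZ h] with z hz
    rw [Kernel.prod_apply, Kernel.prod_apply, hz]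
  rw [condMutualInfo, mutualInfo, Measure.compProd_congr hker,
    ← klDiv_map_measurableEquiv _ _ MeasurableEquiv.prodAssoc.symm]
  congr 1
  · rw [Measure.map_map (MeasurableEquiv.measurable _) (hZ.prodMk (hX.prodMk hY))]
    rfl
  -- Both measures integrate a function by the same iterated integral, because `condDistrib X Z μ`
  -- disintegrates the law of (Z, X).
  · rw [← compProd_map_condDistrib (X := Z) hX.aemeasurable]
    refine Measure.ext_of_lintegral _ fun F hF ↦ ?_
    have hF' : Measurable fun p : γ × α × β ↦ F (MeasurableEquiv.prodAssoc.symm p) :=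
      hF.comp (MeasurableEquiv.measurable _)
    rw [lintegral_map hF (MeasurableEquiv.measurable _), Measure.lintegral_compProd hF',
      lintegral_prod _ hF.aemeasurable, Measure.lintegral_compProd hF.lintegral_prod_right']
    refine lintegral_congr fun z ↦ ?_
    rw [Kernel.prod_apply, Kernel.const_apply, lintegral_prod]
    · rfl
    · exact (hF'.comp measurable_prodMk_left).aemeasurable

lemma log_gaussianPDFReal (m : ℝ) {v : NNReal} (hv : v ≠ 0) (x : ℝ) :
    Real.log (gaussianPDFReal m v x) =
      -(1 / 2) * Real.log (2 * Real.pi * v) - (x - m) ^ 2 / (2 * v) := by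
  have h : (0 : ℝ) < 2 * Real.pi * v := by positivity
  rw [gaussianPDFReal_def, Real.log_mul (by positivity) (Real.exp_ne_zero _), Real.log_exp,
    Real.log_inv, Real.log_sqrt h.le]
  ring

section GaussianChannel

variable {Ω α : Type*} [MeasurableSpace Ω] [MeasurableSpace α] {μ : Measure Ω}
  [IsProbabilityMeasure μ] {X : Ω → α} {Y : Ω → ℝ} {g : α → ℝ} {m m' : ℝ} {s s' : NNReal}

/-- The joint law of the input and the output of an additive Gaussian channel. -/
lemma lintegral_map_prodMk_of_indepFun_gaussianReal (hX : Measurable X) (hY : Measurable Y)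
    (hg : Measurable g) (hind : (fun ω ↦ Y ω - g (X ω)) ⟂ᵢ[μ] X)
    (hnoise : μ.map (fun ω ↦ Y ω - g (X ω)) = gaussianReal m s)
    {F : α × ℝ → ℝ≥0∞} (hF : Measurable F) :
    ∫⁻ p, F p ∂(μ.map fun ω ↦ (X ω, Y ω)) =
      ∫⁻ x, ∫⁻ y, F (x, y) ∂(gaussianReal (m + g x) s) ∂(μ.map X) := by
  have hZ : Measurable fun ω ↦ Y ω - g (X ω) := hY.sub (hg.comp hX)
  have hφ : Measurable fun p : α × ℝ ↦ (p.1, g p.1 + p.2) := by fun_prop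
  have h : μ.map (fun ω ↦ (X ω, Y ω)) =
      ((μ.map X).prod (gaussianReal m s)).map (fun p ↦ (p.1, g p.1 + p.2)) := by
    rw [← hnoise, ← (indepFun_iff_map_prod_eq_prod_map_map hX.aemeasurable hZ.aemeasurable).1
      hind.symm, Measure.map_map hφ (hX.prodMk hZ)]
    congr 1
    ext ω <;> simp
  have hF' : Measurable fun p : α × ℝ ↦ F (p.1, g p.1 + p.2) := hF.comp hφ
  rw [h, lintegral_map hF hφ, lintegral_prod _ hF'.aemeasurable]
  refine lintegral_congr fun x ↦ ?_
  rw [← gaussianReal_map_const_add, lintegral_map (f := fun y ↦ F (x, y))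
    (hF.comp measurable_prodMk_left) (by fun_prop)]

/-- Given X = x, the output has the noise density shifted by g(x); dividing by the output density
gives the density against the product of the marginals. -/
lemma map_prodMk_eq_withDensity (hX : Measurable X) (hY : Measurable Y)
    (hg : Measurable g) (hs : s ≠ 0) (hs' : s' ≠ 0) (hind : (fun ω ↦ Y ω - g (X ω)) ⟂ᵢ[μ] X)
    (hnoise : μ.map (fun ω ↦ Y ω - g (X ω)) = gaussianReal m s)
    (hYlaw : μ.map Y = gaussianReal m' s') :
    μ.map (fun ω ↦ (X ω, Y ω)) = ((μ.map X).prod (μ.map Y)).withDensity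
      fun p ↦ gaussianPDF m s (p.2 - g p.1) / gaussianPDF m' s' p.2 := by
  have hf : Measurable fun p : α × ℝ ↦
      gaussianPDF m s (p.2 - g p.1) / gaussianPDF m' s' p.2 := by
    have := measurable_gaussianPDF m s
    have := measurable_gaussianPDF m' s'
    fun_prop
  refine Measure.ext_of_lintegral _ fun F hF ↦ ?_
  rw [lintegral_map_prodMk_of_indepFun_gaussianReal hX hY hg hind hnoise hF,
    lintegral_withDensity_eq_lintegral_mul _ hf hF, hYlaw,
    lintegral_prod _ (hf.mul hF).aemeasurable]
  refine lintegral_congr fun x ↦ ?_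
  have hF₁ : Measurable fun y ↦ F (x, y) := hF.comp measurable_prodMk_left
  have hF₂ : Measurable fun y ↦ ((fun p : α × ℝ ↦
      gaussianPDF m s (p.2 - g p.1) / gaussianPDF m' s' p.2) * F) (x, y) :=
    (hf.mul hF).comp measurable_prodMk_left
  rw [gaussianReal_of_var_ne_zero _ hs, gaussianReal_of_var_ne_zero _ hs',
    lintegral_withDensity_eq_lintegral_mul _ (measurable_gaussianPDF _ _) hF₁,
    lintegral_withDensity_eq_lintegral_mul _ (measurable_gaussianPDF _ _) hF₂]
  refine lintegral_congr fun y ↦ ?_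
  simp only [Pi.mul_apply]
  rw [← mul_assoc, ENNReal.mul_div_cancel (gaussianPDF_pos m' hs' y).ne' (by simp [gaussianPDF])]
  congr 1
  simp only [gaussianPDF, gaussianPDFReal]
  congr 5
  ring

/-- The mutual information between the input and the output of an additive Gaussian channel with
Gaussian output. -/
lemma mutualInfo_eq_of_gaussian (hX : Measurable X) (hY : Measurable Y)
    (hg : Measurable g) (hs : s ≠ 0) (hs' : s' ≠ 0) (hind : (fun ω ↦ Y ω - g (X ω)) ⟂ᵢ[μ] X)
    (hnoise : μ.map (fun ω ↦ Y ω - g (X ω)) = gaussianReal m s)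
    (hYlaw : μ.map Y = gaussianReal m' s') :
    mutualInfo μ X Y = ENNReal.ofReal (1 / 2 * Real.log (s' / s)) := by
  have := Measure.isProbabilityMeasure_map (μ := μ) hY.aemeasurable
  have := Measure.isProbabilityMeasure_map (μ := μ) hX.aemeasurable
  have := Measure.isProbabilityMeasure_map (μ := μ) (hX.prodMk hY).aemeasurable
  have hZ : Measurable fun ω ↦ Y ω - g (X ω) := hY.sub (hg.comp hX)
  set f : α × ℝ → ℝ≥0∞ := fun p ↦ gaussianPDF m s (p.2 - g p.1) / gaussianPDF m' s' p.2 with hfdef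
  have hf : Measurable f := by
    have := measurable_gaussianPDF m s
    have := measurable_gaussianPDF m' s'
    fun_prop
  have hdens := map_prodMk_eq_withDensity hX hY hg hs hs' hind hnoise hYlaw
  have hac : μ.map (fun ω ↦ (X ω, Y ω)) ≪ (μ.map X).prod (μ.map Y) :=
    hdens ▸ withDensity_absolutelyContinuous _ _
  have hllr : llr (μ.map fun ω ↦ (X ω, Y ω)) ((μ.map X).prod (μ.map Y))
      =ᵐ[μ.map fun ω ↦ (X ω, Y ω)] fun p ↦ 1 / 2 * Real.log (s' / s)
        + ((p.2 - m') ^ 2 / (2 * s') - (p.2 - g p.1 - m) ^ 2 / (2 * s)) := by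
    apply hac.ae_le
    have h1 := Measure.rnDeriv_withDensity ((μ.map X).prod (μ.map Y)) hf
    rw [← hdens] at h1
    filter_upwards [h1] with p hp
    have h2 : (0 : ℝ) < s := by positivity
    have h3 : (0 : ℝ) < s' := by positivity
    rw [llr, hp, hfdef]
    simp only [ENNReal.toReal_div, toReal_gaussianPDF]
    rw [Real.log_div (gaussianPDFReal_pos _ _ _ hs).ne' (gaussianPDFReal_pos _ _ _ hs').ne',
      log_gaussianPDFReal _ hs, log_gaussianPDFReal _ hs', Real.log_div h3.ne' h2.ne',
      Real.log_mul (by positivity) h2.ne', Real.log_mul (by positivity) h3.ne']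
    ring
  -- A centred square divided by twice its variance has mean 1/2, so the two quadratic terms of the
  -- log-likelihood ratio cancel in expectation and only the constant is left.
  have hsq : ∀ {T : Ω → ℝ} {a : ℝ} {v : NNReal}, Measurable T → v ≠ 0 →
      μ.map T = gaussianReal a v → Integrable (fun ω ↦ (T ω - a) ^ 2 / (2 * v)) μ ∧
        ∫ ω, (T ω - a) ^ 2 / (2 * v) ∂μ = 1 / 2 := by
    intro T a v hT hv hlaw
    have hL : HasLaw T (gaussianReal a v) μ := ⟨hT.aemeasurable, hlaw⟩
    have hmem : MemLp T 2 μ := hL.hasGaussianLaw.memLp_two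
    refine ⟨((hmem.sub (memLp_const a)).integrable_sq).div_const _, ?_⟩
    have hv1 : Var[T; μ] = v := by rw [hL.variance_eq, variance_id_gaussianReal]
    have hm1 : ∫ ω, T ω ∂μ = a := by rw [hL.integral_eq]; exact integral_id_gaussianReal
    rw [integral_div, ← hm1, ← variance_eq_integral hT.aemeasurable, hv1]
    have : (v : ℝ) ≠ 0 := by exact_mod_cast hv
    field_simp
  obtain ⟨hi1, he1⟩ := hsq hZ hs hnoise
  obtain ⟨hi2, he2⟩ := hsq hY hs' hYlaw
  have hmeas : Measurable fun p : α × ℝ ↦ 1 / 2 * Real.log (s' / s)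
        + ((p.2 - m') ^ 2 / (2 * s') - (p.2 - g p.1 - m) ^ 2 / (2 * s)) := by fun_prop
  have hint : Integrable (llr (μ.map fun ω ↦ (X ω, Y ω)) ((μ.map X).prod (μ.map Y)))
      (μ.map fun ω ↦ (X ω, Y ω)) := by
    rw [integrable_congr hllr, integrable_map_measure hmeas.aestronglyMeasurable
      (hX.prodMk hY).aemeasurable]
    exact (integrable_const _).add (hi2.sub hi1)
  rw [mutualInfo, klDiv_of_ac_of_integrable hac hint, integral_congr_ae hllr,
    integral_map (hX.prodMk hY).aemeasurable hmeas.aestronglyMeasurable,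
    integral_add (f := fun _ ↦ 1 / 2 * Real.log (s' / s))
      (g := fun ω ↦ (Y ω - m') ^ 2 / (2 * s') - (Y ω - g (X ω) - m) ^ 2 / (2 * s))
      (integrable_const _) (hi2.sub hi1), integral_sub hi2 hi1, he1, he2]
  simp

/-- The mutual information is infinite when a non-degenerate Gaussian variable is a function of the
other variable. -/
lemma mutualInfo_eq_top_of_gaussian (hX : Measurable X) (hY : Measurable Y)
    (hg : Measurable g) (hs' : s' ≠ 0) (h : ∀ᵐ ω ∂μ, Y ω = g (X ω))
    (hYlaw : μ.map Y = gaussianReal m' s') :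
    mutualInfo μ X Y = ∞ := by
  have := Measure.isProbabilityMeasure_map (μ := μ) hY.aemeasurable
  have := nullSingletonClass_gaussianReal (μ := m') hs'
  refine klDiv_of_not_ac fun hac ↦ ?_
  have hA : MeasurableSet {p : α × ℝ | p.2 = g p.1} :=
    measurableSet_eq_fun measurable_snd (hg.comp measurable_fst)
  -- The joint law lives on the graph of g, which is null for the product measure because a
  -- non-degenerate Gaussian has no atoms.
  have h0 : ((μ.map X).prod (μ.map Y)) {p : α × ℝ | p.2 = g p.1} = 0 := by
    rw [Measure.prod_apply hA, hYlaw]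
    refine (lintegral_congr fun x ↦ ?_).trans lintegral_zero
    exact measure_singleton (g x)
  have h1 := hac h0
  rw [Measure.map_apply (hX.prodMk hY) hA] at h1
  have h2 : ∀ᵐ ω ∂μ, False := by
    filter_upwards [h, measure_eq_zero_iff_ae_notMem.1 h1] with ω h3 h4
    exact h4 h3
  exact h2.exists.elim fun _ h ↦ h

end GaussianChannel

/-! ### Covariance, independence and linear regression -/

/-- Lets joint Gaussianity of a tuple be read off an explicit formula in the coordinates of a
Gaussian vector. -/
lemma HasGaussianLaw.comp_linear {Ω E F : Type*} [MeasurableSpace Ω] {μ : Measure Ω}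
    [NormedAddCommGroup E] [NormedSpace ℝ E] [MeasurableSpace E] [BorelSpace E]
    [NormedAddCommGroup F] [NormedSpace ℝ F] [MeasurableSpace F] [BorelSpace F]
    {X : Ω → E} (hX : HasGaussianLaw X μ) (f : E → F) (hadd : ∀ x y, f (x + y) = f x + f y)
    (hsmul : ∀ (c : ℝ) x, f (c • x) = c • f x) (hf : Continuous f) :
    HasGaussianLaw (fun ω ↦ f (X ω)) μ :=
  hX.map_fun (⟨⟨⟨f, hadd⟩, hsmul⟩, hf⟩ : E →L[ℝ] F)

section Covariance

variable {Ω : Type*} [MeasurableSpace Ω] {μ : Measure Ω} [IsProbabilityMeasure μ]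

/-- A variable that is uncorrelated with three others is independent of them if the four are
jointly Gaussian. -/
lemma indepFun_prodMk_of_covariance_eq_zero {D A B C : Ω → ℝ}
    (h : HasGaussianLaw (fun ω ↦ (D ω, A ω, B ω, C ω)) μ)
    (hA : cov[D, A; μ] = 0) (hB : cov[D, B; μ] = 0) (hC : cov[D, C; μ] = 0) :
    D ⟂ᵢ[μ] (fun ω ↦ (A ω, B ω, C ω)) := by
  have mD : MemLp D 2 μ := h.fst.memLp_two
  have mA : MemLp A 2 μ := h.snd.fst.memLp_two
  have mB : MemLp B 2 μ := h.snd.snd.fst.memLp_two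
  have mC : MemLp C 2 μ := h.snd.snd.snd.memLp_two
  refine h.indepFun_of_covariance_strongDual fun L₁ L₂ ↦ ?_
  have e₁ : L₁ ∘ D = L₁ 1 • D := by
    ext ω
    simpa [mul_comm] using L₁.map_smul (D ω) 1
  have e₂ : (L₂ ∘ fun ω ↦ (A ω, B ω, C ω)) =
      L₂ (1, 0, 0) • A + (L₂ (0, 1, 0) • B + L₂ (0, 0, 1) • C) := by
    ext ω
    have : (A ω, B ω, C ω) = A ω • ((1, 0, 0) : ℝ × ℝ × ℝ) + (B ω • ((0, 1, 0) : ℝ × ℝ × ℝ) +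
      C ω • ((0, 0, 1) : ℝ × ℝ × ℝ)) := by simp
    simp only [Function.comp_apply, this, map_add, map_smul]
    simp [mul_comm]
  rw [e₁, e₂, covariance_smul_left, covariance_add_right mD (mA.const_smul _)
    ((mB.const_smul _).add (mC.const_smul _)), covariance_add_right mD (mB.const_smul _)
    (mC.const_smul _)]
  simp [covariance_smul_right, hA, hB, hC]

lemma indepFun_prodMk_of_covariance_eq_zero' {D A B : Ω → ℝ}
    (h : HasGaussianLaw (fun ω ↦ (D ω, A ω, B ω)) μ)
    (hA : cov[D, A; μ] = 0) (hB : cov[D, B; μ] = 0) :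
    D ⟂ᵢ[μ] (fun ω ↦ (A ω, B ω)) := by
  have h' : HasGaussianLaw (fun ω ↦ (D ω, A ω, B ω, B ω)) μ :=
    HasGaussianLaw.comp_linear h (fun p ↦ (p.1, p.2.1, p.2.2, p.2.2))
      (fun _ _ ↦ rfl) (fun _ _ ↦ rfl) (by fun_prop)
  exact (indepFun_prodMk_of_covariance_eq_zero h' hA hB hB).comp measurable_id
    (measurable_fst.prodMk (measurable_fst.comp measurable_snd))

/-- The variance of a linear combination of three uncorrelated variables. -/
lemma variance_smul_add_smul_add_smul {A B C : Ω → ℝ} (hA : MemLp A 2 μ)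
    (hB : MemLp B 2 μ) (hC : MemLp C 2 μ) (hAB : cov[A, B; μ] = 0) (hAC : cov[A, C; μ] = 0)
    (hBC : cov[B, C; μ] = 0) (a b c : ℝ) :
    Var[a • A + b • B + c • C; μ] = a ^ 2 * Var[A; μ] + b ^ 2 * Var[B; μ] + c ^ 2 * Var[C; μ] := by
  have ha := hA.const_smul a
  have hb := hB.const_smul b
  have hc := hC.const_smul c
  rw [variance_add (ha.add hb) hc, variance_add ha hb, covariance_add_left ha hb hc]
  simp only [covariance_smul_left, covariance_smul_right, hAB, hAC, hBC, variance_smul]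
  ring

/-- Linear regression on one variable. -/
lemma exists_covariance_sub_smul_eq_zero {X A : Ω → ℝ} (hX : MemLp X 2 μ) (hA : MemLp A 2 μ) :
    ∃ a : ℝ, cov[X - a • A, A; μ] = 0 := by
  refine ⟨cov[X, A; μ] / Var[A; μ], ?_⟩
  rw [covariance_sub_left hX (hA.const_smul _) hA, covariance_smul_left,
    covariance_self hA.aemeasurable]
  -- If A is degenerate the coefficient is 0 by the convention for division by zero; this is correct
  -- because A is almost surely constant.
  by_cases h : Var[A; μ] = 0
  · have hconst : A =ᵐ[μ] fun _ ↦ ∫ ω, A ω ∂μ := by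
      have := (evariance_eq_zero_iff hA.aemeasurable).1
        (by rw [← hA.ofReal_variance_eq, h, ENNReal.ofReal_zero])
      exact this
    have : cov[X, A; μ] = 0 := by
      rw [covariance]
      refine integral_eq_zero_of_ae ?_
      filter_upwards [hconst] with ω hω
      simp [hω]
    simp [h, this]
  · field_simp
    simp

/-- Linear regression on two variables. -/
lemma exists_covariance_sub_smul_sub_smul_eq_zero {X A B : Ω → ℝ} (hX : MemLp X 2 μ)
    (hA : MemLp A 2 μ) (hB : MemLp B 2 μ) :
    ∃ a b : ℝ, cov[X - a • A - b • B, A; μ] = 0 ∧ cov[X - a • A - b • B, B; μ] = 0 := by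
  -- Gram–Schmidt: regress X on A, then on the residual of B given A.
  obtain ⟨d, hd⟩ := exists_covariance_sub_smul_eq_zero hB hA
  obtain ⟨a, ha⟩ := exists_covariance_sub_smul_eq_zero hX hA
  have hB' : MemLp (B - d • A) 2 μ := hB.sub (hA.const_smul d)
  have hX' : MemLp (X - a • A) 2 μ := hX.sub (hA.const_smul a)
  obtain ⟨b, hb⟩ := exists_covariance_sub_smul_eq_zero hX' hB'
  have h₁ : cov[X - a • A - b • (B - d • A), A; μ] = 0 := by
    rw [covariance_sub_left hX' (hB'.const_smul b) hA, covariance_smul_left, ha, hd]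
    simp
  have e : X - (a - b * d) • A - b • B = X - a • A - b • (B - d • A) := by
    ext ω
    simp
    ring
  refine ⟨a - b * d, b, e ▸ h₁, e ▸ ?_⟩
  have hR : MemLp (X - a • A - b • (B - d • A)) 2 μ := hX'.sub (hB'.const_smul b)
  rw [covariance_sub_right hR hB (hA.const_smul d), covariance_smul_right, h₁] at hb
  simpa using hb

/-- If `U` and `W` are conditionally independent given `K`, then the residual of `U` with respect
to its regression function on `K` is uncorrelated with `W`. -/
lemma covariance_sub_comp_eq_zero_of_condIndepFun [StandardBorelSpace Ω] {γ : Type*}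
    [MeasurableSpace γ] {U W : Ω → ℝ} {K : Ω → γ} {f : γ → ℝ} (hU : Measurable U)
    (hW : Measurable W) (hK : Measurable K) (hf : Measurable f)
    (h : U ⟂ᵢ[K, hK; μ] W) (hU2 : MemLp U 2 μ) (hW2 : MemLp W 2 μ)
    (hfK : MemLp (f ∘ K) 2 μ) (hind : (U - f ∘ K) ⟂ᵢ[μ] K) :
    cov[U - f ∘ K, W; μ] = 0 := by
  have hR2 : MemLp (U - f ∘ K) 2 μ := hU2.sub hfK
  have hRm : Measurable (U - f ∘ K) := hU.sub (hf.comp hK)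
  have hKW : Measurable fun ω ↦ (K ω, W ω) := hK.prodMk hW
  have hm := hKW.comap_le
  have hm' := hK.comap_le
  set m := MeasurableSpace.comap (fun ω ↦ (K ω, W ω)) inferInstance with hmdef
  have hKm : MeasurableSpace.comap K inferInstance ≤ m := by
    rw [hmdef, ← measurable_iff_comap_le]
    exact measurable_fst.comp (comap_measurable (fun ω ↦ (K ω, W ω)))
  have hWm : StronglyMeasurable[m] W :=
    (measurable_snd.comp (comap_measurable (fun ω ↦ (K ω, W ω)))).stronglyMeasurable
  have hfm' : StronglyMeasurable[MeasurableSpace.comap K inferInstance] (f ∘ K) :=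
    (hf.comp (comap_measurable K)).stronglyMeasurable
  have hUi : Integrable U μ := hU2.integrable (by norm_num)
  have hfi : Integrable (f ∘ K) μ := hfK.integrable (by norm_num)
  have hRi : Integrable (U - f ∘ K) μ := hR2.integrable (by norm_num)
  -- By conditional independence, W adds nothing to K for predicting U.
  have e₁ : μ[U | m] =ᵐ[μ] μ[U | MeasurableSpace.comap K inferInstance] := by
    have h1 := condExp_ae_eq_integral_condDistrib (μ := μ) hKW hU.aemeasurable
      (f := id) stronglyMeasurable_id hUi
    have h2 := condExp_ae_eq_integral_condDistrib (μ := μ) hK hU.aemeasurable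
      (f := id) stronglyMeasurable_id hUi
    have h3 := ae_of_ae_map hKW.aemeasurable
      ((condIndepFun_iff_condDistrib_prod_ae_eq_prodMkRight hU hW hK).1 h.symm)
    filter_upwards [h1, h2, h3] with ω h1 h2 h3
    refine h1.trans (Eq.trans ?_ h2.symm)
    rw [h3, Kernel.prodMkRight_apply]
  have e₂ : μ[U - f ∘ K | m] =ᵐ[μ] μ[U - f ∘ K | MeasurableSpace.comap K inferInstance] := by
    have h1 := condExp_sub hUi hfi m
    have h2 := condExp_sub hUi hfi (MeasurableSpace.comap K inferInstance)
    rw [condExp_of_stronglyMeasurable hm (hfm'.mono hKm) hfi] at h1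
    rw [condExp_of_stronglyMeasurable hm' hfm' hfi] at h2
    filter_upwards [e₁, h1, h2] with ω h3 h1 h2
    rw [h1, h2, Pi.sub_apply, Pi.sub_apply, h3]
  -- The residual is independent of K, so its conditional mean given (K, W) is constant; pulling W
  -- out then factors the expectation of the product.
  have e₃ : μ[U - f ∘ K | m] =ᵐ[μ] fun _ ↦ ∫ ω, (U - f ∘ K) ω ∂μ :=
    e₂.trans (condExp_indep_eq hRm.comap_le hm' (comap_measurable _).stronglyMeasurable hind)
  have hWR : Integrable (W * (U - f ∘ K)) μ := hW2.integrable_mul hR2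
  have e₄ : ∫ ω, (W * (U - f ∘ K)) ω ∂μ = (∫ ω, W ω ∂μ) * ∫ ω, (U - f ∘ K) ω ∂μ := by
    rw [← integral_condExp hm, ← integral_mul_const]
    refine integral_congr_ae ?_
    filter_upwards [condExp_mul_of_stronglyMeasurable_left hWm hWR hRi, e₃] with ω h1 h2
    rw [h1, Pi.mul_apply, h2]
  rw [covariance_comm, covariance_eq_sub hW2 hR2, e₄, sub_self]

end Covariance

/-! ### Information quantities and MMSE in the regression model -/

/-- Jointly Gaussian variables `X₀, W₁, W₂, V, Z` with `X₀` and `W₁` uncorrelated, `V` uncorrelated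
with `X₀, W₁, W₂`, and `Z` uncorrelated with all the others, where `α W₁ + β W₂` is the linear
regression of `X₀` on `W₁, W₂`, with residual `D`. -/
structure IsRegression {Ω : Type*} [MeasurableSpace Ω] (μ : Measure Ω)
    (X₀ W₁ W₂ V Z D : Ω → ℝ) (α β : ℝ) : Prop where
  measurable_X₀ : Measurable X₀
  measurable_W₁ : Measurable W₁
  measurable_W₂ : Measurable W₂
  measurable_V : Measurable V
  measurable_Z : Measurable Z
  gaussian : HasGaussianLaw (fun ω ↦ (X₀ ω, W₁ ω, W₂ ω, V ω, Z ω)) μ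
  eq : X₀ = D + (α • W₁ + β • W₂)
  cov_X₀_W₁ : cov[X₀, W₁; μ] = 0
  cov_D_W₁ : cov[D, W₁; μ] = 0
  cov_D_W₂ : cov[D, W₂; μ] = 0
  cov_V_X₀ : cov[V, X₀; μ] = 0
  cov_V_W₁ : cov[V, W₁; μ] = 0
  cov_V_W₂ : cov[V, W₂; μ] = 0
  cov_Z_X₀ : cov[Z, X₀; μ] = 0
  cov_Z_W₁ : cov[Z, W₁; μ] = 0
  cov_Z_W₂ : cov[Z, W₂; μ] = 0
  cov_Z_V : cov[Z, V; μ] = 0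

namespace IsRegression

variable {Ω : Type} [MeasurableSpace Ω] {μ : Measure Ω} {X₀ W₁ W₂ V Z D : Ω → ℝ}
  {α β : ℝ} (h : IsRegression μ X₀ W₁ W₂ V Z D α β)
include h

lemma D_eq : D = X₀ - (α • W₁ + β • W₂) := by rw [h.eq, add_sub_cancel_right]

lemma memLp_X₀ : MemLp X₀ 2 μ := h.gaussian.fst.memLp_two
lemma memLp_W₁ : MemLp W₁ 2 μ := h.gaussian.snd.fst.memLp_two
lemma memLp_W₂ : MemLp W₂ 2 μ := h.gaussian.snd.snd.fst.memLp_two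
lemma memLp_V : MemLp V 2 μ := h.gaussian.snd.snd.snd.fst.memLp_two
lemma memLp_Z : MemLp Z 2 μ := h.gaussian.snd.snd.snd.snd.memLp_two

lemma measurable_D : Measurable D :=
  h.D_eq ▸ h.measurable_X₀.sub ((h.measurable_W₁.const_smul _).add (h.measurable_W₂.const_smul _))

lemma memLp_D : MemLp D 2 μ :=
  h.D_eq ▸ h.memLp_X₀.sub ((h.memLp_W₁.const_smul _).add (h.memLp_W₂.const_smul _))

variable [IsProbabilityMeasure μ]

lemma cov_V_D : cov[V, D; μ] = 0 := by
  rw [h.D_eq, covariance_sub_right h.memLp_V h.memLp_X₀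
    ((h.memLp_W₁.const_smul _).add (h.memLp_W₂.const_smul _)), covariance_add_right h.memLp_V
    (h.memLp_W₁.const_smul _) (h.memLp_W₂.const_smul _), covariance_smul_right,
    covariance_smul_right, h.cov_V_X₀, h.cov_V_W₁, h.cov_V_W₂]
  simp

lemma cov_Z_D : cov[Z, D; μ] = 0 := by
  rw [h.D_eq, covariance_sub_right h.memLp_Z h.memLp_X₀
    ((h.memLp_W₁.const_smul _).add (h.memLp_W₂.const_smul _)), covariance_add_right h.memLp_Z
    (h.memLp_W₁.const_smul _) (h.memLp_W₂.const_smul _), covariance_smul_right,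
    covariance_smul_right, h.cov_Z_X₀, h.cov_Z_W₁, h.cov_Z_W₂]
  simp

lemma variance_D_le : Var[D; μ] ≤ Var[X₀; μ] := by
  have h0 : cov[D, α • W₁ + β • W₂; μ] = 0 := by
    rw [covariance_add_right h.memLp_D (h.memLp_W₁.const_smul _) (h.memLp_W₂.const_smul _),
      covariance_smul_right, covariance_smul_right, h.cov_D_W₁, h.cov_D_W₂]
    simp
  rw [h.eq, variance_add h.memLp_D ((h.memLp_W₁.const_smul _).add (h.memLp_W₂.const_smul _)), h0]
  have := variance_nonneg (α • W₁ + β • W₂) μ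
  linarith

lemma indepFun_D : D ⟂ᵢ[μ] (fun ω ↦ (W₁ ω, W₂ ω)) := by
  refine indepFun_prodMk_of_covariance_eq_zero' ?_ h.cov_D_W₁ h.cov_D_W₂
  rw [h.D_eq]
  refine HasGaussianLaw.comp_linear h.gaussian
    (fun p ↦ (p.1 - (α * p.2.1 + β * p.2.2.1), p.2.1, p.2.2.1)) (fun x y ↦ ?_) (fun c x ↦ ?_)
    (by fun_prop)
  · ext <;> simp <;> ring
  · ext <;> simp <;> ring

/-- `I(W₂; X₀ | W₁)` when the regression of `X₀` on `W₁, W₂` has a non-zero error. -/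
lemma condMutualInfo_eq (hD : Var[D; μ] ≠ 0) :
    condMutualInfo μ W₂ X₀ W₁ = ENNReal.ofReal (1 / 2 * Real.log (Var[X₀; μ] / Var[D; μ])) := by
  have hDp : 0 < Var[D; μ] := lt_of_le_of_ne (variance_nonneg _ _) hD.symm
  have hXp : 0 < Var[X₀; μ] := hDp.trans_le h.variance_D_le
  have hXW : HasGaussianLaw (fun ω ↦ (X₀ ω, W₁ ω)) μ :=
    HasGaussianLaw.comp_linear h.gaussian (fun p ↦ (p.1, p.2.1)) (fun _ _ ↦ rfl) (fun _ _ ↦ rfl)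
      (by fun_prop)
  rw [condMutualInfo_eq_mutualInfo_of_indepFun h.measurable_W₂ h.measurable_X₀ h.measurable_W₁
    (hXW.indepFun_of_covariance_eq_zero h.cov_X₀_W₁)]
  have hDg : HasGaussianLaw D μ := by
    rw [h.D_eq]
    exact HasGaussianLaw.comp_linear h.gaussian (fun p ↦ p.1 - (α * p.2.1 + β * p.2.2.1))
      (fun x y ↦ by simp; ring) (fun c x ↦ by simp; ring) (by fun_prop)
  have e : (fun ω ↦ X₀ ω - (α * W₁ ω + β * W₂ ω)) = D := by
    rw [h.D_eq]
    rfl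
  have key := mutualInfo_eq_of_gaussian (μ := μ) (X := fun ω ↦ (W₁ ω, W₂ ω)) (Y := X₀)
    (g := fun p ↦ α * p.1 + β * p.2) (m := ∫ ω, D ω ∂μ) (s := Var[D; μ].toNNReal)
    (m' := ∫ ω, X₀ ω ∂μ) (s' := Var[X₀; μ].toNNReal)
    (h.measurable_W₁.prodMk h.measurable_W₂) h.measurable_X₀ (by fun_prop)
    (by simpa using hDp) (by simpa using hXp) (e ▸ h.indepFun_D)
    (e ▸ hDg.map_eq_gaussianReal) h.gaussian.fst.map_eq_gaussianReal
  rw [key, Real.coe_toNNReal _ hDp.le, Real.coe_toNNReal _ hXp.le]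

/-- `I(W₂; X₀ | W₁)` when `X₀` is an affine function of `W₁, W₂`. -/
lemma condMutualInfo_eq_top (hX : 0 < Var[X₀; μ]) (hD : Var[D; μ] = 0) :
    condMutualInfo μ W₂ X₀ W₁ = ∞ := by
  have hXW : HasGaussianLaw (fun ω ↦ (X₀ ω, W₁ ω)) μ :=
    HasGaussianLaw.comp_linear h.gaussian (fun p ↦ (p.1, p.2.1)) (fun _ _ ↦ rfl) (fun _ _ ↦ rfl)
      (by fun_prop)
  rw [condMutualInfo_eq_mutualInfo_of_indepFun h.measurable_W₂ h.measurable_X₀ h.measurable_W₁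
    (hXW.indepFun_of_covariance_eq_zero h.cov_X₀_W₁)]
  have hconst : D =ᵐ[μ] fun _ ↦ ∫ ω, D ω ∂μ :=
    (evariance_eq_zero_iff h.memLp_D.aemeasurable).1
      (by rw [← h.memLp_D.ofReal_variance_eq, hD, ENNReal.ofReal_zero])
  refine mutualInfo_eq_top_of_gaussian (g := fun p ↦ (∫ ω, D ω ∂μ) + (α * p.1 + β * p.2))
    (h.measurable_W₁.prodMk h.measurable_W₂) h.measurable_X₀ (by fun_prop)
    (s' := Var[X₀; μ].toNNReal) (by simpa using hX) ?_ h.gaussian.fst.map_eq_gaussianReal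
  filter_upwards [hconst] with ω hω
  rw [← hω]
  exact congrFun h.eq ω

variable (a b : ℝ)

/-- `I(W₁, W₂; Y₁)`. -/
lemma mutualInfo_eq (hZ : 0 < Var[Z; μ]) :
    mutualInfo μ (fun ω ↦ (W₁ ω, W₂ ω)) (a • X₀ + b • W₁ + V + Z) =
      ENNReal.ofReal (1 / 2 * Real.log
        ((a ^ 2 * Var[X₀; μ] + b ^ 2 * Var[W₁; μ] + Var[V; μ] + Var[Z; μ]) /
          (a ^ 2 * Var[D; μ] + Var[V; μ] + Var[Z; μ]))) := by
  -- R is the part of the output not explained by W₁, W₂: the output is that of a Gaussian channel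
  -- with noise R.
  set R : Ω → ℝ := a • D + (1 : ℝ) • V + (1 : ℝ) • Z with hRdef
  have hR2 : MemLp R 2 μ := ((h.memLp_D.const_smul _).add (h.memLp_V.const_smul _)).add
    (h.memLp_Z.const_smul _)
  have hX2 : MemLp (a • X₀ + b • W₁ + V) 2 μ :=
    ((h.memLp_X₀.const_smul _).add (h.memLp_W₁.const_smul _)).add h.memLp_V
  have hXZ : cov[a • X₀ + b • W₁ + V, Z; μ] = 0 := by
    rw [covariance_add_left ((h.memLp_X₀.const_smul _).add (h.memLp_W₁.const_smul _)) h.memLp_V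
      h.memLp_Z, covariance_add_left (h.memLp_X₀.const_smul _) (h.memLp_W₁.const_smul _) h.memLp_Z,
      covariance_smul_left, covariance_smul_left, covariance_comm, h.cov_Z_X₀, covariance_comm,
      h.cov_Z_W₁, covariance_comm, h.cov_Z_V]
    simp
  have hYvar : Var[a • X₀ + b • W₁ + V + Z; μ] =
      a ^ 2 * Var[X₀; μ] + b ^ 2 * Var[W₁; μ] + Var[V; μ] + Var[Z; μ] := by
    have := variance_smul_add_smul_add_smul h.memLp_X₀ h.memLp_W₁ h.memLp_V h.cov_X₀_W₁
      (covariance_comm V X₀ ▸ h.cov_V_X₀) (covariance_comm V W₁ ▸ h.cov_V_W₁) a b 1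
    rw [one_smul] at this
    rw [variance_add hX2 h.memLp_Z, this, hXZ]
    ring
  have hRvar : Var[R; μ] = a ^ 2 * Var[D; μ] + Var[V; μ] + Var[Z; μ] := by
    rw [variance_smul_add_smul_add_smul h.memLp_D h.memLp_V h.memLp_Z
      (covariance_comm V D ▸ h.cov_V_D) (covariance_comm Z D ▸ h.cov_Z_D)
      (covariance_comm Z V ▸ h.cov_Z_V)]
    ring
  have hcov : ∀ {T : Ω → ℝ}, MemLp T 2 μ → cov[D, T; μ] = 0 → cov[V, T; μ] = 0 →
      cov[Z, T; μ] = 0 → cov[R, T; μ] = 0 := by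
    intro T hT h1 h2 h3
    rw [hRdef, covariance_add_left ((h.memLp_D.const_smul _).add (h.memLp_V.const_smul _))
      (h.memLp_Z.const_smul _) hT, covariance_add_left (h.memLp_D.const_smul _)
      (h.memLp_V.const_smul _) hT]
    simp [covariance_smul_left, h1, h2, h3]
  have hRind : R ⟂ᵢ[μ] (fun ω ↦ (W₁ ω, W₂ ω)) := by
    refine indepFun_prodMk_of_covariance_eq_zero' ?_
      (hcov h.memLp_W₁ h.cov_D_W₁ h.cov_V_W₁ h.cov_Z_W₁)
      (hcov h.memLp_W₂ h.cov_D_W₂ h.cov_V_W₂ h.cov_Z_W₂)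
    rw [hRdef, h.D_eq]
    refine HasGaussianLaw.comp_linear h.gaussian
      (fun p ↦ (a * (p.1 - (α * p.2.1 + β * p.2.2.1)) + 1 * p.2.2.2.1 + 1 * p.2.2.2.2,
        p.2.1, p.2.2.1)) (fun x y ↦ ?_) (fun c x ↦ ?_) (by fun_prop)
    · ext <;> simp <;> ring
    · ext <;> simp <;> ring
  have hYg : HasGaussianLaw (a • X₀ + b • W₁ + V + Z) μ :=
    HasGaussianLaw.comp_linear h.gaussian
      (fun p ↦ a * p.1 + b * p.2.1 + p.2.2.2.1 + p.2.2.2.2) (fun x y ↦ by simp; ring)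
      (fun c x ↦ by simp; ring) (by fun_prop)
  have hRg : HasGaussianLaw R μ := by
    rw [hRdef, h.D_eq]
    exact HasGaussianLaw.comp_linear h.gaussian
      (fun p ↦ a * (p.1 - (α * p.2.1 + β * p.2.2.1)) + 1 * p.2.2.2.1 + 1 * p.2.2.2.2)
      (fun x y ↦ by simp; ring) (fun c x ↦ by simp; ring) (by fun_prop)
  have hRp : 0 < Var[R; μ] := by
    have h1 := variance_nonneg D μ
    have h2 := variance_nonneg V μ
    rw [hRvar]
    positivity
  have hYp : 0 < Var[a • X₀ + b • W₁ + V + Z; μ] := by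
    have h1 := variance_nonneg X₀ μ
    have h2 := variance_nonneg V μ
    have h3 := variance_nonneg W₁ μ
    rw [hYvar]
    positivity
  have e : (fun ω ↦ (a • X₀ + b • W₁ + V + Z) ω - ((a * α + b) * W₁ ω + a * β * W₂ ω)) = R := by
    ext ω
    simp only [hRdef, h.D_eq, Pi.add_apply, Pi.sub_apply, Pi.smul_apply, smul_eq_mul]
    ring
  have key := mutualInfo_eq_of_gaussian (μ := μ) (X := fun ω ↦ (W₁ ω, W₂ ω))
    (Y := a • X₀ + b • W₁ + V + Z)
    (g := fun p ↦ (a * α + b) * p.1 + a * β * p.2) (m := ∫ ω, R ω ∂μ) (s := Var[R; μ].toNNReal)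
    (m' := ∫ ω, (a • X₀ + b • W₁ + V + Z) ω ∂μ) (s' := Var[a • X₀ + b • W₁ + V + Z; μ].toNNReal)
    (h.measurable_W₁.prodMk h.measurable_W₂)
    ((((h.measurable_X₀.const_smul _).add (h.measurable_W₁.const_smul _)).add h.measurable_V).add
      h.measurable_Z) (by fun_prop)
    (by simpa using hRp) (by simpa using hYp) (e ▸ hRind)
    (e ▸ hRg.map_eq_gaussianReal) hYg.map_eq_gaussianReal
  rw [key, Real.coe_toNNReal _ hRp.le, Real.coe_toNNReal _ hYp.le, hRvar, hYvar]

/-- The MMSE estimation error of `X₁ = a X₀ + b W₁ + V` from `W₁, W₂, X₁ + Z`, up to its mean. -/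
lemma sub_mmse_ae_eq (hZ : 0 < Var[Z; μ]) {τ : ℝ} (hτ : τ = a ^ 2 * Var[D; μ] + Var[V; μ])
    {E : Ω → ℝ} (hE : E = (Var[Z; μ] / (τ + Var[Z; μ])) • (a • D + V) - (τ / (τ + Var[Z; μ])) • Z) :
    mmse μ W₁ W₂ (a • X₀ + b • W₁ + V) (a • X₀ + b • W₁ + V + Z) =ᵐ[μ]
      fun ω ↦ (a • X₀ + b • W₁ + V) ω - E ω + ∫ ω, E ω ∂μ := by
  have hτ0 : 0 ≤ τ := by
    have h1 := variance_nonneg D μ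
    have h2 := variance_nonneg V μ
    rw [hτ]
    positivity
  have hne : τ + Var[Z; μ] ≠ 0 := by positivity
  set N := Var[Z; μ] with hN
  set X₁ := a • X₀ + b • W₁ + V with hX₁
  have mD := h.memLp_D
  have mV := h.memLp_V
  have mZ := h.memLp_Z
  have mX₁ : MemLp X₁ 2 μ :=
    ((h.memLp_X₀.const_smul _).add (h.memLp_W₁.const_smul _)).add h.memLp_V
  have hX₁m : Measurable X₁ :=
    ((h.measurable_X₀.const_smul _).add (h.measurable_W₁.const_smul _)).add h.measurable_V
  have mR : MemLp (a • D + V) 2 μ := (mD.const_smul _).add mV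
  have mE : MemLp E 2 μ := hE ▸ (mR.const_smul _).sub (mZ.const_smul _)
  have hEm : Measurable E := hE ▸
    (((h.measurable_D.const_smul _).add h.measurable_V).const_smul _).sub
      (h.measurable_Z.const_smul _)
  have hcov : ∀ {T : Ω → ℝ}, MemLp T 2 μ → cov[E, T; μ] = N / (τ + N) * (a * cov[D, T; μ]
      + cov[V, T; μ]) - τ / (τ + N) * cov[Z, T; μ] := by
    intro T hT
    rw [hE, covariance_sub_left (mR.const_smul _) (mZ.const_smul _) hT, covariance_smul_left,
      covariance_smul_left, covariance_add_left (mD.const_smul _) mV hT, covariance_smul_left]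
  have hW₁ : cov[E, W₁; μ] = 0 := by
    rw [hcov h.memLp_W₁, h.cov_D_W₁, h.cov_V_W₁, h.cov_Z_W₁]
    simp
  have hW₂ : cov[E, W₂; μ] = 0 := by
    rw [hcov h.memLp_W₂, h.cov_D_W₂, h.cov_V_W₂, h.cov_Z_W₂]
    simp
  have hED : cov[E, D; μ] = N / (τ + N) * (a * Var[D; μ]) := by
    rw [hcov mD, covariance_self mD.aemeasurable, h.cov_V_D, h.cov_Z_D]
    simp
  have hEV : cov[E, V; μ] = N / (τ + N) * Var[V; μ] := by
    rw [hcov mV, covariance_self mV.aemeasurable, covariance_comm, h.cov_V_D, h.cov_Z_V]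
    simp
  have hEZ : cov[E, Z; μ] = - (τ / (τ + N) * N) := by
    rw [hcov mZ, covariance_self mZ.aemeasurable, covariance_comm, h.cov_Z_D, covariance_comm,
      h.cov_Z_V]
    simp [hN]
  -- The weights in E are chosen for this: aD + V contributes Nτ/(τ+N) and Z contributes the
  -- opposite.
  have hY : cov[E, X₁ + Z; μ] = 0 := by
    have e : X₁ + Z = a • D + V + Z + ((a * α + b) • W₁ + (a * β) • W₂) := by
      ext ω
      simp only [hX₁, h.D_eq, Pi.add_apply, Pi.sub_apply, Pi.smul_apply, smul_eq_mul]
      ring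
    rw [e, covariance_add_right mE (mR.add mZ)
      ((h.memLp_W₁.const_smul _).add (h.memLp_W₂.const_smul _)), covariance_add_right mE
      (h.memLp_W₁.const_smul _) (h.memLp_W₂.const_smul _), covariance_add_right mE mR mZ,
      covariance_add_right mE (mD.const_smul _) mV]
    simp only [covariance_smul_right, hW₁, hW₂, hED, hEV, hEZ]
    rw [hτ]
    ring
  have hind : E ⟂ᵢ[μ] (fun ω ↦ (W₁ ω, W₂ ω, (X₁ + Z) ω)) := by
    refine indepFun_prodMk_of_covariance_eq_zero ?_ hW₁ hW₂ hY
    rw [hE, h.D_eq, hX₁]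
    refine HasGaussianLaw.comp_linear h.gaussian
      (fun p ↦ (N / (τ + N) * (a * (p.1 - (α * p.2.1 + β * p.2.2.1)) + p.2.2.2.1)
        - τ / (τ + N) * p.2.2.2.2, p.2.1, p.2.2.1, a * p.1 + b * p.2.1 + p.2.2.2.1 + p.2.2.2.2))
      (fun x y ↦ ?_) (fun c x ↦ ?_) (by fun_prop)
    · ext <;> simp <;> ring
    · ext <;> simp <;> ring
  have hObs : Measurable fun ω ↦ (W₁ ω, W₂ ω, (X₁ + Z) ω) :=
    h.measurable_W₁.prodMk (h.measurable_W₂.prodMk (hX₁m.add h.measurable_Z))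
  have hm := hObs.comap_le
  -- X₁ - E is a linear function of the observations and E is independent of them, so X₁ - E is the
  -- conditional mean up to the mean of E.
  have hfun : X₁ - E = (fun p : ℝ × ℝ × ℝ ↦ (1 - τ / (τ + N)) * ((a * α + b) * p.1 + a * β * p.2.1)
      + τ / (τ + N) * p.2.2) ∘ (fun ω ↦ (W₁ ω, W₂ ω, (X₁ + Z) ω)) := by
    have e : N / (τ + N) = 1 - τ / (τ + N) := by
      field_simp
      ring
    rw [hE, e]
    ext ω
    simp only [hX₁, h.D_eq, Function.comp_apply, Pi.add_apply, Pi.sub_apply, Pi.smul_apply,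
      smul_eq_mul]
    ring
  have hmeas : StronglyMeasurable[MeasurableSpace.comap (fun ω ↦ (W₁ ω, W₂ ω, (X₁ + Z) ω))
      inferInstance] (X₁ - E) := by
    rw [hfun]
    refine (Measurable.comp ?_ (comap_measurable _)).stronglyMeasurable
    fun_prop
  have hXi : Integrable X₁ μ := mX₁.integrable (by norm_num)
  have hEi : Integrable E μ := mE.integrable (by norm_num)
  have h1 := condExp_indep_eq hEm.comap_le hm (comap_measurable E).stronglyMeasurable hind
  have h2 := condExp_add (hXi.sub hEi) hEi
    (MeasurableSpace.comap (fun ω ↦ (W₁ ω, W₂ ω, (X₁ + Z) ω)) inferInstance)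
  rw [condExp_of_stronglyMeasurable hm hmeas (hXi.sub hEi), sub_add_cancel] at h2
  filter_upwards [h1, h2] with ω h1 h2
  rw [mmse, h2, Pi.add_apply, h1, Pi.sub_apply]

/-- The MMSE cost. -/
lemma integral_sub_mmse_sq (hZ : 0 < Var[Z; μ]) {τ : ℝ}
    (hτ : τ = a ^ 2 * Var[D; μ] + Var[V; μ]) :
    ∫ ω, ((a • X₀ + b • W₁ + V) ω -
      mmse μ W₁ W₂ (a • X₀ + b • W₁ + V) (a • X₀ + b • W₁ + V + Z) ω) ^ 2 ∂μ =
      τ * Var[Z; μ] / (τ + Var[Z; μ]) := by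
  have hτ0 : 0 ≤ τ := by
    have h1 := variance_nonneg D μ
    have h2 := variance_nonneg V μ
    rw [hτ]
    positivity
  have hne : τ + Var[Z; μ] ≠ 0 := by positivity
  obtain ⟨E, hE⟩ : ∃ E : Ω → ℝ, E = (Var[Z; μ] / (τ + Var[Z; μ])) • (a • D + V) -
    (τ / (τ + Var[Z; μ])) • Z := ⟨_, rfl⟩
  have hE' : E = (Var[Z; μ] / (τ + Var[Z; μ]) * a) • D + (Var[Z; μ] / (τ + Var[Z; μ])) • V +
      (-(τ / (τ + Var[Z; μ]))) • Z := by
    rw [hE, smul_add, smul_smul, neg_smul, sub_eq_add_neg]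
  have hEm : Measurable E := hE ▸
    (((h.measurable_D.const_smul _).add h.measurable_V).const_smul _).sub
      (h.measurable_Z.const_smul _)
  have hvar : Var[E; μ] = τ * Var[Z; μ] / (τ + Var[Z; μ]) := by
    rw [hE', variance_smul_add_smul_add_smul h.memLp_D h.memLp_V h.memLp_Z
      (covariance_comm V D ▸ h.cov_V_D) (covariance_comm Z D ▸ h.cov_Z_D)
      (covariance_comm Z V ▸ h.cov_Z_V)]
    have : (Var[Z; μ] / (τ + Var[Z; μ]) * a) ^ 2 * Var[D; μ] +
        (Var[Z; μ] / (τ + Var[Z; μ])) ^ 2 * Var[V; μ] =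
        (Var[Z; μ] / (τ + Var[Z; μ])) ^ 2 * τ := by
      rw [hτ]
      ring
    rw [this]
    field_simp
    ring
  rw [← hvar, variance_eq_integral hEm.aemeasurable]
  refine integral_congr_ae ?_
  filter_upwards [h.sub_mmse_ae_eq a b hZ hτ hE] with ω hω
  rw [hω]
  ring

end IsRegression

/-! ### Reduction to real parameters -/

/-- Every Gaussian cost is `τ N / (τ + N)` with `τ = (1 + a)² σ + v`, where `a` is the regression
coefficient of `U₁` on `X₀`, where `B` and `v` are the variances of the parts of `U₁` that come from
`W₁` and from the independent residual, and where `σ` is the error of `X₀` given `W₁, W₂`. -/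
lemma exists_of_mem_gaussianCosts {Q N P S : ℝ} (hQ : 0 < Q) (hN : 0 < N)
    (hS : S ∈ gaussianCosts Q N P) :
    ∃ a σ v B : ℝ, 0 ≤ σ ∧ 0 ≤ v ∧ 0 ≤ B ∧ a ^ 2 * Q + B + v ≤ P ∧
      Q * (v + N) ≤ σ * (B + v + N) ∧
      S = ((1 + a) ^ 2 * σ + v) * N / ((1 + a) ^ 2 * σ + v + N) := by
  obtain ⟨Ω, _, _, μ, _, X₀, W₁, W₂, U₁, X₁, Y₁, hsys, hG, hpow, hinfo, hcost⟩ := hS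
  have mX₀ : MemLp X₀ 2 μ := hG.fst.memLp_two
  have mW₁ : MemLp W₁ 2 μ := hG.snd.fst.memLp_two
  have mW₂ : MemLp W₂ 2 μ := hG.snd.snd.fst.memLp_two
  have mU₁ : MemLp U₁ 2 μ := hG.snd.snd.snd.fst.memLp_two
  have mX₁ : MemLp X₁ 2 μ := hG.snd.snd.snd.snd.fst.memLp_two
  have mY₁ : MemLp Y₁ 2 μ := hG.snd.snd.snd.snd.snd.fst.memLp_two
  have hmX₀ := hsys.measurable_X₀
  have hmW₁ := hsys.measurable_W₁
  have hmW₂ := hsys.measurable_W₂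
  have hmU₁ := hsys.measurable_U₁
  obtain ⟨a, b, hVX, hVW⟩ := exists_covariance_sub_smul_sub_smul_eq_zero mU₁ mX₀ mW₁
  obtain ⟨α, β, hDW₁, hDW₂⟩ := exists_covariance_sub_smul_sub_smul_eq_zero mX₀ mW₁ mW₂
  set V := U₁ - a • X₀ - b • W₁ with hV
  have mV : MemLp V 2 μ := (mU₁.sub (mX₀.const_smul _)).sub (mW₁.const_smul _)
  obtain ⟨Z, hZ⟩ : ∃ Z : Ω → ℝ, Z = fun ω ↦ Y₁ ω - X₁ ω := ⟨_, rfl⟩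
  have mZ : MemLp Z 2 μ := hZ ▸ mY₁.sub mX₁
  have hZlaw : HasLaw Z (gaussianReal 0 N.toNNReal) μ := hZ ▸ hsys.law_noise
  have hZind : Z ⟂ᵢ[μ] (fun ω ↦ (X₀ ω, W₁ ω, W₂ ω, U₁ ω)) := hZ ▸ hsys.indep_noise
  have hZX : cov[Z, X₀; μ] = 0 :=
    (hZind.comp measurable_id measurable_fst).covariance_eq_zero mZ mX₀
  have hZW₁ : cov[Z, W₁; μ] = 0 :=
    (hZind.comp measurable_id (measurable_fst.comp measurable_snd)).covariance_eq_zero mZ mW₁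
  have hZW₂ : cov[Z, W₂; μ] = 0 :=
    (hZind.comp measurable_id (measurable_fst.comp (measurable_snd.comp
      measurable_snd))).covariance_eq_zero mZ mW₂
  have hZV : cov[Z, V; μ] = 0 := by
    have : Measurable fun p : ℝ × ℝ × ℝ × ℝ ↦ p.2.2.2 - a * p.1 - b * p.2.1 := by fun_prop
    exact (hZind.comp measurable_id this).covariance_eq_zero mZ mV
  -- The Markov chain U₁ - (X₀, W₁) - W₂ enters here.
  have hVW₂ : cov[V, W₂; μ] = 0 := by
    have hf : Measurable fun p : ℝ × ℝ ↦ a * p.1 + b * p.2 := by fun_prop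
    have e : V = U₁ - (fun p : ℝ × ℝ ↦ a * p.1 + b * p.2) ∘ (fun ω ↦ (X₀ ω, W₁ ω)) := by
      ext ω
      simp [hV]
      ring
    have hVind : V ⟂ᵢ[μ] (fun ω ↦ (X₀ ω, W₁ ω)) := by
      refine indepFun_prodMk_of_covariance_eq_zero' ?_ hVX hVW
      refine HasGaussianLaw.comp_linear hG
        (fun p ↦ (p.2.2.2.1 - a * p.1 - b * p.2.1, p.1, p.2.1)) (fun x y ↦ ?_) (fun c x ↦ ?_)
        (by fun_prop)
      · ext <;> simp
        ring
      · ext <;> simp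
        ring
    rw [e] at hVind ⊢
    exact covariance_sub_comp_eq_zero_of_condIndepFun hmU₁ hmW₂ (hmX₀.prodMk hmW₁) hf
      hsys.condIndep_U₁_W₂ mU₁ mW₂ ((mX₀.const_mul a).add (mW₁.const_mul b)) hVind
  have hReg : IsRegression μ X₀ W₁ W₂ V Z (X₀ - α • W₁ - β • W₂) α β := by
    refine ⟨hmX₀, hmW₁, hmW₂, (hmU₁.sub (hmX₀.const_smul a)).sub (hmW₁.const_smul b),
      hZ ▸ hsys.measurable_Y₁.sub hsys.measurable_X₁, ?_, ?_,
      hsys.indep_X₀_W₁.covariance_eq_zero mX₀ mW₁, hDW₁, hDW₂, hVX, hVW, hVW₂, hZX, hZW₁, hZW₂,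
      hZV⟩
    · rw [hZ]
      refine HasGaussianLaw.comp_linear hG
        (fun p ↦ (p.1, p.2.1, p.2.2.1, p.2.2.2.1 - a * p.1 - b * p.2.1,
          p.2.2.2.2.2.1 - p.2.2.2.2.1)) (fun x y ↦ ?_) (fun c x ↦ ?_) (by fun_prop)
      · ext <;> simp <;> ring
      · ext <;> simp <;> ring
    · ext ω
      simp
  have eX₁ : X₁ = (1 + a) • X₀ + b • W₁ + V := by
    ext ω
    rw [hsys.X₁_eq ω]
    simp [hV]
    ring
  have eY₁ : Y₁ = (1 + a) • X₀ + b • W₁ + V + Z := by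
    rw [← eX₁, hZ]
    ext ω
    simp
  have vX₀ : Var[X₀; μ] = Q := by
    rw [hsys.law_X₀.variance_eq, variance_id_gaussianReal, Real.coe_toNNReal _ hQ.le]
  have vZ : Var[Z; μ] = N := by
    rw [hZlaw.variance_eq, variance_id_gaussianReal, Real.coe_toNNReal _ hN.le]
  set D := X₀ - α • W₁ - β • W₂
  have vD := variance_nonneg D μ
  have vV := variance_nonneg V μ
  have vW := variance_nonneg W₁ μ
  refine ⟨a, Var[D; μ], Var[V; μ], b ^ 2 * Var[W₁; μ], vD, vV, by positivity, ?_, ?_, ?_⟩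
  -- Only an inequality results, since U₁ may have a non-zero mean.
  · have e : U₁ = a • X₀ + b • W₁ + (1 : ℝ) • V := by
      ext ω
      simp [hV]
    have h1 := variance_le_expectation_sq (X := U₁) (μ := μ) mU₁.aestronglyMeasurable
    have h2 : Var[U₁; μ] = _ := e ▸ variance_smul_add_smul_add_smul mX₀ mW₁ mV hReg.cov_X₀_W₁
      (covariance_comm V X₀ ▸ hVX) (covariance_comm V W₁ ▸ hVW) a b 1
    rw [h2, vX₀] at h1
    have h3 : μ[U₁ ^ 2] = P := hpow
    linarith
  -- With σ = 0 the term I(W₂;X₀|W₁) would be infinite, while I(W₁,W₂;Y₁) is finite.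
  · have hD : Var[D; μ] ≠ 0 := by
      intro h0
      rw [hReg.condMutualInfo_eq_top (by rw [vX₀]; exact hQ) h0, eY₁,
        hReg.mutualInfo_eq _ _ (by rw [vZ]; exact hN)] at hinfo
      exact ENNReal.ofReal_ne_top (top_le_iff.1 hinfo)
    have hDp : 0 < Var[D; μ] := lt_of_le_of_ne vD hD.symm
    have hDQ : Var[D; μ] ≤ Q := vX₀ ▸ hReg.variance_D_le
    rw [hReg.condMutualInfo_eq hD, eY₁, hReg.mutualInfo_eq _ _ (by rw [vZ]; exact hN), vX₀, vZ]
      at hinfo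
    have hden : 0 < (1 + a) ^ 2 * Var[D; μ] + Var[V; μ] + N := by positivity
    -- `ENNReal.ofReal` truncates at 0, so the logarithms can be compared only once the larger one
    -- is known to be non-negative.
    have hnum : (1 + a) ^ 2 * Var[D; μ] + Var[V; μ] + N ≤
        (1 + a) ^ 2 * Q + b ^ 2 * Var[W₁; μ] + Var[V; μ] + N := by
      have h1 : (1 + a) ^ 2 * Var[D; μ] ≤ (1 + a) ^ 2 * Q := by gcongr
      have h2 : 0 ≤ b ^ 2 * Var[W₁; μ] := by positivity
      linarith
    have hlog := Real.log_nonneg ((one_le_div hden).2 hnum)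
    have h3 := (ENNReal.ofReal_le_ofReal_iff (by positivity)).1 hinfo
    have h4 := (Real.log_le_log_iff (by positivity) (by positivity)).1
      (le_of_mul_le_mul_left h3 (by norm_num : (0 : ℝ) < 1 / 2))
    -- After cross-multiplication the terms (1+a)²Qσ cancel.
    rw [div_le_div_iff₀ hDp hden] at h4
    linarith
  · rw [← hcost, eY₁, eX₁, hReg.integral_sub_mmse_sq _ _ (by rw [vZ]; exact hN) rfl, vZ]

/-! ### Minimisation over the parameters -/

section Algebra

variable {Q N P a σ v B : ℝ}

/-- Eliminates σ: the constraint times (1+a)², plus (v+N)(B+v+N) on both sides. -/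
lemma mul_le_of_information_constraint (h : Q * (v + N) ≤ σ * (B + v + N)) :
    (v + N) * ((1 + a) ^ 2 * Q + (B + v + N)) ≤
      ((1 + a) ^ 2 * σ + v + N) * (B + v + N) := by
  nlinarith [mul_le_mul_of_nonneg_left h (sq_nonneg (1 + a))]

/-- The cost is N - N²/T with T = τ + N, so the claim amounts to T(N+P) ≥ NQ. -/
lemma tangent_le_cost (hQ : 0 < Q) (hN : 0 < N) (hσ : 0 ≤ σ) (hv : 0 ≤ v) (hB : 0 ≤ B)
    (hpow : a ^ 2 * Q + B + v ≤ P) (h : Q * (v + N) ≤ σ * (B + v + N)) :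
    N * (Q - N - P) / Q ≤
      ((1 + a) ^ 2 * σ + v) * N / ((1 + a) ^ 2 * σ + v + N) := by
  have hK : 0 < B + v + N := by positivity
  have hT : 0 < (1 + a) ^ 2 * σ + v + N := by positivity
  have h1 := mul_le_of_information_constraint (a := a) h
  set K := B + v + N
  set T := (1 + a) ^ 2 * σ + v + N with hTdef
  have hPK : a ^ 2 * Q + K ≤ N + P := by simp only [K]; linarith
  have hPp : 0 < N + P := by
    have : 0 ≤ a ^ 2 * Q := by positivity
    linarith
  -- The difference of the two sides is exactly ((1+a)aQ + K)².
  have h2 : Q * K ≤ ((1 + a) ^ 2 * Q + K) * (a ^ 2 * Q + K) := by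
    nlinarith [sq_nonneg ((1 + a) * a * Q + K)]
  have h3 : N * Q ≤ T * (N + P) := by
    refine le_of_mul_le_mul_right ?_ hK
    calc N * Q * K = N * (Q * K) := by ring
      _ ≤ N * (((1 + a) ^ 2 * Q + K) * (a ^ 2 * Q + K)) := by gcongr
      _ ≤ (v + N) * (((1 + a) ^ 2 * Q + K) * (N + P)) := by gcongr; linarith
      _ = (v + N) * ((1 + a) ^ 2 * Q + K) * (N + P) := by ring
      _ ≤ T * K * (N + P) := by gcongr
      _ = T * (N + P) * K := by ring
  have e : (1 + a) ^ 2 * σ + v = T - N := by rw [hTdef]; ring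
  rw [e, div_le_div_iff₀ hQ hT]
  nlinarith [mul_le_mul_of_nonneg_left h3 hN.le]

/-- With K at its upper bound, the two sides agree at s = -t. Their difference is (s+t) times an
affine function of s+t with non-negative coefficients; t q ≤ N + t² is what makes the constant
coefficient non-negative. -/
lemma sq_sub_mul_le_of_sq_le {q s t K : ℝ} (hN : 0 ≤ N) (htq : t ≤ q) (hs : -t ≤ s)
    (hK : K ≤ N + t ^ 2 - s ^ 2) (h : t * q ≤ N + t ^ 2) :
    (q - t) ^ 2 * K ≤ N * (q + s) ^ 2 := by
  have h₁ : 0 ≤ (q - t) * (N - t * (q - t)) := mul_nonneg (by linarith) (by linarith)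
  have h₂ : 0 ≤ (s + t) * (N + (q - t) ^ 2) := mul_nonneg (by linarith) (by positivity)
  have h₃ : 0 ≤ (s + t) * (2 * ((q - t) * (N - t * (q - t))) + (s + t) * (N + (q - t) ^ 2)) :=
    mul_nonneg (by linarith) (by linarith)
  calc (q - t) ^ 2 * K ≤ (q - t) ^ 2 * (N + t ^ 2 - s ^ 2) := by gcongr
    _ ≤ (q - t) ^ 2 * (N + t ^ 2 - s ^ 2) +
        (s + t) * (2 * ((q - t) * (N - t * (q - t))) + (s + t) * (N + (q - t) ^ 2)) := by linarith
    _ = N * (q + s) ^ 2 := by ring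

/-- In terms of q = √Q, t = √P, s = aq, the claim is τ ≥ (q-t)², the value of τ when s = -t and B =
v = 0. -/
lemma linear_le_cost (hQ : 0 < Q) (hN : 0 < N) (hP : 0 ≤ P) (hPQ : P ≤ Q)
    (hσ : 0 ≤ σ) (hv : 0 ≤ v) (hB : 0 ≤ B)
    (hpow : a ^ 2 * Q + B + v ≤ P) (h : Q * (v + N) ≤ σ * (B + v + N))
    (hout : P * Q ≤ (N + P) ^ 2) :
    (√Q - √P) ^ 2 * N / ((√Q - √P) ^ 2 + N) ≤
      ((1 + a) ^ 2 * σ + v) * N / ((1 + a) ^ 2 * σ + v + N) := by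
  have hK : 0 < B + v + N := by positivity
  have h1 := mul_le_of_information_constraint (a := a) h
  have hPK : a ^ 2 * Q + (B + v + N) ≤ N + P := by linarith
  set K := B + v + N
  set τ := (1 + a) ^ 2 * σ + v with hτ
  have hτ0 : 0 ≤ τ := by positivity
  obtain ⟨q, hq, hq0⟩ : ∃ q, q = √Q ∧ 0 < q := ⟨_, rfl, Real.sqrt_pos.2 hQ⟩
  obtain ⟨t, ht, ht0⟩ : ∃ t, t = √P ∧ 0 ≤ t := ⟨_, rfl, Real.sqrt_nonneg P⟩
  have hqQ : q ^ 2 = Q := by rw [hq, Real.sq_sqrt hQ.le]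
  have htP : t ^ 2 = P := by rw [ht, Real.sq_sqrt hP]
  have htq : t ≤ q := by rw [hq, ht]; exact Real.sqrt_le_sqrt hPQ
  rw [← hq, ← ht]
  obtain ⟨s, hs⟩ : ∃ s, s = a * q := ⟨_, rfl⟩
  have hs2 : s ^ 2 = a ^ 2 * Q := by rw [hs, mul_pow, hqQ]
  have hsq : (1 + a) ^ 2 * Q = (q + s) ^ 2 := by rw [hs, ← hqQ]; ring
  have hst : s ^ 2 ≤ t ^ 2 := by
    rw [hs2, htP]
    linarith
  have hs1 : -t ≤ s := (abs_le_of_sq_le_sq' hst ht0).1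
  have htq' : t * q ≤ N + t ^ 2 := by
    rw [← htP, ← hqQ, ← mul_pow] at hout
    exact (abs_le_of_sq_le_sq' hout (by positivity)).2
  have h2 : (q - t) ^ 2 * K ≤ N * (q + s) ^ 2 :=
    sq_sub_mul_le_of_sq_le hN.le htq hs1 (by linarith) htq'
  have h8 : (q - t) ^ 2 ≤ τ := by
    have h9 : N * ((q + s) ^ 2 + K) ≤ (τ + N) * K := by
      refine le_trans ?_ h1
      rw [hsq]
      gcongr
      linarith
    refine le_of_mul_le_mul_right ?_ hK
    linarith
  rw [div_le_div_iff₀ (by positivity) (by positivity)]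
  linarith [mul_le_mul_of_nonneg_left h8 (sq_nonneg N)]

/-- The interval `[P₁, P₂]` is where the tangent lies below the linear cost. -/
lemma mem_Icc_iff (hQ : 0 < Q) (hQN : 4 * N < Q) :
    P ∈ Set.Icc (P₁ Q N) (P₂ Q N) ↔ (N + P) ^ 2 ≤ P * Q := by
  -- P₁ and P₂ are the roots of (N+P)² = PQ, whose discriminant this is.
  have hd : 0 ≤ Q ^ 2 - 4 * Q * N := by nlinarith
  have h1 := Real.sq_sqrt hd
  have h0 := Real.sqrt_nonneg (Q ^ 2 - 4 * Q * N)
  simp only [Set.mem_Icc, P₁, P₂]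
  set r := √(Q ^ 2 - 4 * Q * N)
  constructor
  · rintro ⟨h2, h3⟩
    nlinarith [mul_nonneg (sub_nonneg.2 h2) (sub_nonneg.2 h3)]
  · intro h
    have h2 : (2 * P - (Q - 2 * N)) ^ 2 ≤ r ^ 2 := by nlinarith
    obtain ⟨h3, h4⟩ := abs_le_of_sq_le_sq' h2 h0
    constructor <;> linarith

end Algebra

/-! ### Attaining schemes -/

/-- Independent standard Gaussian variables have a realization on `ℝ⁴`. -/
lemma exists_iIndepFun_standardGaussian :
    ∃ (μ : Measure (Fin 4 → ℝ)) (_ : IsProbabilityMeasure μ) (G : Fin 4 → (Fin 4 → ℝ) → ℝ),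
      (∀ i, Measurable (G i)) ∧ (∀ i, HasLaw (G i) (gaussianReal 0 1) μ) ∧ iIndepFun G μ := by
  refine ⟨Measure.pi fun _ ↦ gaussianReal 0 1, inferInstance, fun i ω ↦ ω i,
    fun i ↦ measurable_pi_apply i, fun i ↦ ?_, ?_⟩
  · exact ⟨(measurable_pi_apply i).aemeasurable,
      (measurePreserving_eval (fun _ : Fin 4 ↦ gaussianReal 0 1) i).map_eq⟩
  · exact iIndepFun_pi (X := fun _ x ↦ x) (fun _ ↦ aemeasurable_id)

/-- The cost of the linear scheme `U₁ = a X₀ + b W₁`, `W₂ = c X₀ + G` with `b² = P - a² Q` and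
`c² = b² / (N Q)`, where `W₁` and `G` are independent standard Gaussian variables. -/
lemma mem_gaussianCosts {Q N P a : ℝ} (hQ : 0 < Q) (hN : 0 < N) (ha : a ^ 2 * Q ≤ P) :
    ((1 + a) ^ 2 * (Q * N / (P - a ^ 2 * Q + N))) * N /
      ((1 + a) ^ 2 * (Q * N / (P - a ^ 2 * Q + N)) + N) ∈ gaussianCosts Q N P := by
  obtain ⟨μ, _, G, hGm, hGlaw, hGind⟩ := exists_iIndepFun_standardGaussian
  have mG : ∀ i, MemLp (G i) 2 μ := fun i ↦ (hGlaw i).hasGaussianLaw.memLp_two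
  have vG : ∀ i, Var[G i; μ] = 1 := fun i ↦ by
    rw [(hGlaw i).variance_eq, variance_id_gaussianReal, NNReal.coe_one]
  have cG : ∀ {i j}, i ≠ j → cov[G i, G j; μ] = 0 := fun hij ↦
    (hGind.indepFun hij).covariance_eq_zero (mG _) (mG _)
  have eG : ∀ i, ∫ ω, G i ω ∂μ = 0 := fun i ↦ by
    rw [(hGlaw i).integral_eq]
    exact integral_id_gaussianReal
  have hGvec : HasGaussianLaw (fun ω i ↦ G i ω) μ :=
    hGind.hasGaussianLaw fun i ↦ (hGlaw i).hasGaussianLaw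
  obtain ⟨B, hB⟩ : ∃ B, B = P - a ^ 2 * Q := ⟨_, rfl⟩
  have hB0 : 0 ≤ B := by linarith
  have hBN : 0 < B + N := by linarith
  obtain ⟨b, hb⟩ : ∃ b : ℝ, b ^ 2 = B := ⟨√B, Real.sq_sqrt hB0⟩
  -- This c gives σ = QN/(B+N), the smallest value that the information constraint allows when v =
  -- 0.
  obtain ⟨c, hc⟩ : ∃ c : ℝ, c ^ 2 = B / (N * Q) :=
    ⟨√(B / (N * Q)), Real.sq_sqrt (by positivity)⟩
  obtain ⟨q, hq⟩ : ∃ q : ℝ, q ^ 2 = Q := ⟨√Q, Real.sq_sqrt hQ.le⟩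
  obtain ⟨n, hn⟩ : ∃ n : ℝ, n ^ 2 = N := ⟨√N, Real.sq_sqrt hN.le⟩
  rw [← hB]
  set X₀ : (Fin 4 → ℝ) → ℝ := q • G 0 with hX₀
  set W₁ : (Fin 4 → ℝ) → ℝ := G 1 with hW₁
  set W₂ : (Fin 4 → ℝ) → ℝ := c • X₀ + G 2 with hW₂
  set U₁ : (Fin 4 → ℝ) → ℝ := a • X₀ + b • W₁ with hU₁
  set Z : (Fin 4 → ℝ) → ℝ := n • G 3 with hZ
  -- The regression coefficient cQ/(c²Q + 1) of X₀ on W₂; W₁ gets coefficient 0, being independent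
  -- of (X₀, W₂).
  set β : ℝ := c * Q * N / (B + N) with hβ
  set D : (Fin 4 → ℝ) → ℝ := (N / (B + N)) • X₀ + (-β) • G 2 with hD
  have hβc : 1 - β * c = N / (B + N) := by
    have : β * c = c ^ 2 * (Q * N / (B + N)) := by rw [hβ]; ring
    rw [this, hc]
    field_simp
    ring
  have mX₀ : MemLp X₀ 2 μ := (mG 0).const_smul q
  have hmX₀ : Measurable X₀ := (hGm 0).const_smul q
  have hmW₂ : Measurable W₂ := (hmX₀.const_smul c).add (hGm 2)
  have hmU₁ : Measurable U₁ := (hmX₀.const_smul a).add ((hGm 1).const_smul b)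
  have hmZ : Measurable Z := (hGm 3).const_smul n
  have vX₀ : Var[X₀; μ] = Q := by rw [hX₀, variance_smul, vG, mul_one, hq]
  have vZ : Var[Z; μ] = N := by rw [hZ, variance_smul, vG, mul_one, hn]
  have cX : ∀ {i}, i ≠ 0 → cov[X₀, G i; μ] = 0 := fun hi ↦ by
    rw [hX₀, covariance_smul_left, cG hi.symm, mul_zero]
  have cZX : cov[Z, X₀; μ] = 0 := by
    rw [hZ, hX₀, covariance_smul_left, covariance_smul_right, cG (by decide)]
    simp
  have cZ : ∀ {i}, i ≠ 3 → cov[Z, G i; μ] = 0 := fun hi ↦ by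
    rw [hZ, covariance_smul_left, cG hi.symm, mul_zero]
  have vD : Var[D; μ] = Q * N / (B + N) := by
    have h1 := variance_smul_add_smul_add_smul mX₀ (mG 2) (mG 1) (cX (by decide)) (cX (by decide))
      (cG (by decide)) (N / (B + N)) (-β) 0
    rw [zero_smul, add_zero] at h1
    rw [hD, h1, vX₀, vG, vG, neg_sq, hβ]
    have h2 : (c * Q * N / (B + N)) ^ 2 = c ^ 2 * (Q * N / (B + N)) ^ 2 := by ring
    rw [h2, hc]
    field_simp
    ring
  have hReg : IsRegression μ X₀ W₁ W₂ 0 Z D 0 β := by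
    have mX' := mX₀.const_smul (N / (B + N))
    have mG' := (mG 2).const_smul (-β)
    refine ⟨hmX₀, hGm 1, hmW₂, measurable_const, hmZ, ?_, ?_, cX (by decide), ?_, ?_,
      covariance_zero_left, covariance_zero_left, covariance_zero_left, cZX, cZ (by decide), ?_,
      covariance_zero_right⟩
    · refine HasGaussianLaw.comp_linear hGvec
        (fun p ↦ (q * p 0, p 1, c * (q * p 0) + p 2, 0, n * p 3)) (fun x y ↦ ?_) (fun t x ↦ ?_)
        (by fun_prop)
      · ext <;> simp <;> ring
      · ext <;> simp <;> ring
    · rw [hD, hW₂, ← hβc]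
      ext ω
      simp
      ring
    · rw [hD, covariance_add_left mX' mG' (mG 1), covariance_smul_left (X := X₀),
        covariance_smul_left (X := G 2), cX (by decide), cG (by decide)]
      simp
    · rw [hD, hW₂, covariance_add_left mX' mG' ((mX₀.const_smul c).add (mG 2)),
        covariance_smul_left (X := X₀), covariance_smul_left (X := G 2),
        covariance_add_right mX₀ (mX₀.const_smul c) (mG 2),
        covariance_add_right (mG 2) (mX₀.const_smul c) (mG 2), covariance_smul_right (Y := X₀),
        covariance_smul_right (Y := X₀), covariance_self mX₀.aemeasurable,
        covariance_self (mG 2).aemeasurable, covariance_comm (G 2) X₀, cX (by decide), vX₀, vG, hβ]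
      ring
    · rw [hW₂, covariance_add_right ((mG 3).const_smul n) (mX₀.const_smul c) (mG 2),
        covariance_smul_right, cZX, cZ (by decide)]
      simp
  set X₁ : (Fin 4 → ℝ) → ℝ := (1 + a) • X₀ + b • W₁ + 0 with hX₁
  have hmX₁ : Measurable X₁ :=
    ((hmX₀.const_smul (1 + a)).add ((hGm 1).const_smul b)).add measurable_const
  refine ⟨Fin 4 → ℝ, inferInstance, inferInstance, μ, inferInstance, X₀, W₁, W₂, U₁, X₁, X₁ + Z,
    ⟨hmX₀, hGm 1, hmW₂, hmU₁, hmX₁, hmX₁.add hmZ, ?_, ?_, ?_, ?_, ?_, ?_⟩, ?_, ?_, ?_, ?_⟩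
  · have h1 := gaussianReal_const_mul (hGlaw 0) q
    have h2 : NNReal.mk (q ^ 2) (sq_nonneg q) * 1 = Q.toNNReal := by
      ext
      simp [hq, hQ.le]
    rw [mul_zero, h2] at h1
    exact h1
  · exact (hGind.indepFun (by decide : (0 : Fin 4) ≠ 1)).comp (measurable_id.const_mul q)
      measurable_id
  -- U₁ is a function of (X₀, W₁), so the Markov chain is automatic.
  · refine condIndepFun_of_measurable_left ?_ hmW₂
    have h1 : Measurable fun p : ℝ × ℝ ↦ a * p.1 + b * p.2 := by fun_prop
    exact h1.comp (comap_measurable fun ω ↦ (X₀ ω, W₁ ω))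
  · intro ω
    simp [hX₁, hU₁]
    ring
  · have h1 := gaussianReal_const_mul (hGlaw 3) n
    have h2 : NNReal.mk (n ^ 2) (sq_nonneg n) * 1 = N.toNNReal := by
      ext
      simp [hn, hN.le]
    rw [mul_zero, h2] at h1
    have h3 : (fun ω ↦ (X₁ + Z) ω - X₁ ω) = fun ω ↦ n * G 3 ω := by
      ext ω
      simp [hZ]
    rwa [h3]
  · have h1 := hGind.indepFun_finset {3} {0, 1, 2} (by decide) hGm
    have h3 : (fun ω ↦ (X₁ + Z) ω - X₁ ω) = fun ω ↦ n * G 3 ω := by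
      ext ω
      simp [hZ]
    rw [h3]
    have h4 : Measurable fun p : ({3} : Finset (Fin 4)) → ℝ ↦ n * p ⟨3, by decide⟩ := by fun_prop
    have h5 : Measurable fun p : ({0, 1, 2} : Finset (Fin 4)) → ℝ ↦
        (q * p ⟨0, by decide⟩, p ⟨1, by decide⟩, c * (q * p ⟨0, by decide⟩) + p ⟨2, by decide⟩,
          a * (q * p ⟨0, by decide⟩) + b * p ⟨1, by decide⟩) := by fun_prop
    exact h1.comp h4 h5
  -- The decision must be Gaussian jointly with the rest: as E has mean 0, it is almost surely X₁ -
  -- E, a linear function of the vector G.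
  · obtain ⟨τ, hτ⟩ : ∃ τ, τ = (1 + a) ^ 2 * Var[D; μ] + Var[(0 : (Fin 4 → ℝ) → ℝ); μ] :=
      ⟨_, rfl⟩
    obtain ⟨E, hE⟩ : ∃ E : (Fin 4 → ℝ) → ℝ, E = (Var[Z; μ] / (τ + Var[Z; μ])) • ((1 + a) • D + 0) -
      (τ / (τ + Var[Z; μ])) • Z := ⟨_, rfl⟩
    have hmm := hReg.sub_mmse_ae_eq (1 + a) b (by rw [vZ]; exact hN) hτ hE
    have hE0 : ∫ ω, E ω ∂μ = 0 := by
      have iG : ∀ i, Integrable (G i) μ := fun i ↦ (mG i).integrable (by norm_num)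
      have e : E = fun ω ↦ Var[Z; μ] / (τ + Var[Z; μ]) * (1 + a) * (N / (B + N)) * q * G 0 ω +
          -(Var[Z; μ] / (τ + Var[Z; μ]) * (1 + a) * β) * G 2 ω +
          -(τ / (τ + Var[Z; μ]) * n) * G 3 ω := by
        rw [hE]
        ext ω
        simp [hD, hX₀, hZ]
        ring
      rw [e]
      refine (integral_add (((iG 0).const_mul _).add ((iG 2).const_mul _))
        ((iG 3).const_mul _)).trans ?_
      refine (congrArg (· + _) (integral_add ((iG 0).const_mul _) ((iG 2).const_mul _))).trans ?_
      simp only [integral_const_mul, eG, mul_zero, add_zero]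
    generalize Var[Z; μ] / (τ + Var[Z; μ]) = r at hE
    generalize τ / (τ + Var[Z; μ]) = r' at hE
    have hlin : HasGaussianLaw (fun ω ↦ (X₀ ω, W₁ ω, W₂ ω, U₁ ω, X₁ ω, (X₁ + Z) ω,
        X₁ ω - E ω)) μ := by
      rw [hE]
      refine HasGaussianLaw.comp_linear hGvec
        (fun p ↦ (q * p 0, p 1, c * (q * p 0) + p 2, a * (q * p 0) + b * p 1,
          (1 + a) * (q * p 0) + b * p 1 + 0, (1 + a) * (q * p 0) + b * p 1 + 0 + n * p 3,
          (1 + a) * (q * p 0) + b * p 1 + 0 -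
            (r * ((1 + a) * (N / (B + N) * (q * p 0) + -β * p 2) + 0) - r' * (n * p 3))))
        (fun x y ↦ ?_) (fun t x ↦ ?_) (by fun_prop)
      · ext <;> simp <;> ring
      · ext <;> simp <;> ring
    refine hlin.congr ?_
    filter_upwards [hmm] with ω hω
    rw [hω, hE0, add_zero]
  · have h1 := variance_smul_add_smul_add_smul mX₀ (mG 1) (mG 2) (cX (by decide)) (cX (by decide))
      (cG (by decide)) a b 0
    rw [zero_smul, add_zero, vX₀, vG, hb] at h1
    have iX : Integrable X₀ μ := mX₀.integrable (by norm_num)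
    have i1 : Integrable (G 1) μ := (mG 1).integrable (by norm_num)
    have h2 : ∫ ω, U₁ ω ∂μ = 0 := by
      have e : U₁ = fun ω ↦ a * q * G 0 ω + b * G 1 ω := by
        ext ω
        simp [hU₁, hX₀, hW₁]
        ring
      have i0 : Integrable (G 0) μ := (mG 0).integrable (by norm_num)
      rw [e, integral_add (i0.const_mul _) (i1.const_mul _)]
      simp [integral_const_mul, eG]
    rw [← variance_of_integral_eq_zero hmU₁.aemeasurable h2, hU₁, h1, hB]
    ring
  · have hσ : 0 < Q * N / (B + N) := by positivity
    rw [hReg.condMutualInfo_eq (by rw [vD]; exact hσ.ne'), hX₁,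
      hReg.mutualInfo_eq _ _ (by rw [vZ]; exact hN), vX₀, vD, vZ, vG, hb]
    refine le_of_eq ?_
    congr 3
    have h0 : Var[(0 : (Fin 4 → ℝ) → ℝ); μ] = 0 := variance_zero μ
    have h1 : 0 < (1 + a) ^ 2 * (Q * N / (B + N)) + 0 + N := by positivity
    rw [h0, div_eq_div_iff hσ.ne' h1.ne']
    field_simp
    ring
  · have h0 : Var[(0 : (Fin 4 → ℝ) → ℝ); μ] = 0 := variance_zero μ
    rw [hReg.integral_sub_mmse_sq (1 + a) b (by rw [vZ]; exact hN) rfl, vD, vZ, h0, add_zero]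

/-! ### The optimum -/

/-- The infimum of the Gaussian costs is attained, and its value. -/
lemma isLeast_gaussianCosts {Q N P : ℝ} (hQ : 0 < Q) (hN : 0 < N) (hP : 0 ≤ P) :
    IsLeast (gaussianCosts Q N P)
      (if 4 * N < Q ∧ P ∈ Set.Icc (P₁ Q N) (P₂ Q N) then N * (Q - N - P) / Q
        else linearCost Q N P) := by
  split_ifs with hcase
  · obtain ⟨hQN, hmem⟩ := hcase
    rw [mem_Icc_iff hQ hQN] at hmem
    have hNP : 0 < N + P := by linarith
    have hlt : 0 < Q - N - P := by
      by_contra hle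
      have h1 : Q * (N + P) ≤ (N + P) ^ 2 := by
        rw [sq]
        exact mul_le_mul_of_nonneg_right (by linarith) hNP.le
      nlinarith [mul_pos hQ hN]
    refine ⟨?_, ?_⟩
    -- Equality in the square requires K = -a(1+a)Q; together with a²Q + K = N + P this forces a =
    -- -(N+P)/Q.
    · have e : (-((N + P) / Q)) ^ 2 * Q = (N + P) ^ 2 / Q := by field_simp
      have ha : (-((N + P) / Q)) ^ 2 * Q ≤ P := by
        rw [e]
        exact (div_le_iff₀ hQ).2 hmem
      have h1 := mem_gaussianCosts hQ hN ha
      have h2 : P - (-((N + P) / Q)) ^ 2 * Q + N = (N + P) * (Q - N - P) / Q := by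
        field_simp
        ring
      have h3 : (1 + -((N + P) / Q)) ^ 2 * (Q * N / ((N + P) * (Q - N - P) / Q)) =
          N * (Q - N - P) / (N + P) := by
        have h4 : 1 + -((N + P) / Q) = (Q - N - P) / Q := by
          field_simp
          ring
        rw [h4]
        field_simp
      have h5 : N * (Q - N - P) / (N + P) + N = N * Q / (N + P) := by
        field_simp
        ring
      rw [h2, h3, h5] at h1
      convert h1 using 1
      field_simp
    · intro S hS
      obtain ⟨a, σ, v, B, hσ, hv, hB, hpow, hinfo, rfl⟩ := exists_of_mem_gaussianCosts hQ hN hS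
      exact tangent_le_cost hQ hN hσ hv hB hpow hinfo
  · rw [linearCost]
    split_ifs with hPQ
    · have hout : P * Q ≤ (N + P) ^ 2 := by
        by_cases hQN : 4 * N < Q
        · by_contra hlt
          exact hcase ⟨hQN, (mem_Icc_iff hQ hQN).2 (not_le.1 hlt).le⟩
        -- For Q ≤ 4N, PQ ≤ 4NP ≤ (N+P)².
        · nlinarith [sq_nonneg (N - P), mul_nonneg hP (sub_nonneg.2 (not_lt.1 hQN))]
      refine ⟨?_, ?_⟩
      · have hq : 0 < √Q := Real.sqrt_pos.2 hQ
        have hq2 := Real.sq_sqrt hQ.le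
        -- All power goes into shrinking X₀, so B = 0 and σ = Q.
        have e : (-(√P / √Q)) ^ 2 * Q = P := by
          rw [neg_sq, div_pow, Real.sq_sqrt hP, hq2]
          field_simp
        have h1 := mem_gaussianCosts hQ hN e.le
        have h2 : (1 + -(√P / √Q)) ^ 2 * (Q * N / N) = (√Q - √P) ^ 2 := by
          rw [mul_div_assoc, div_self hN.ne', mul_one]
          nth_rewrite 2 [← hq2]
          rw [← mul_pow]
          congr 1
          field_simp
          ring
        rwa [e, sub_self, zero_add, h2] at h1
      · intro S hS
        obtain ⟨a, σ, v, B, hσ, hv, hB, hpow, hinfo, rfl⟩ := exists_of_mem_gaussianCosts hQ hN hS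
        exact linear_le_cost hQ hN hP hPQ.2 hσ hv hB hpow hinfo hout
    · have hlt : Q < P := not_le.1 fun hle ↦ hPQ ⟨hP, hle⟩
      refine ⟨?_, ?_⟩
      -- X₀ is cancelled completely and the surplus power P - Q is spent on W₁, which the decoder
      -- knows.
      · have h1 := mem_gaussianCosts (a := -1) hQ hN (by linarith : (-1) ^ 2 * Q ≤ P)
        simpa using h1
      · intro S hS
        obtain ⟨a, σ, v, B, hσ, hv, hB, hpow, hinfo, rfl⟩ := exists_of_mem_gaussianCosts hQ hN hS
        positivity

end Witsenhausen

/-- The first conjunct says that the infimum in the definition of `gaussianOptimalCost` is a genuine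
one: the set of costs is non-empty and bounded below. -/
theorem theorem2 (Q N P : ℝ) (hQ : 0 < Q) (hN : 0 < N) (hP : 0 ≤ P) :
    IsGLB (Witsenhausen.gaussianCosts Q N P) (Witsenhausen.gaussianOptimalCost Q N P) ∧
    Witsenhausen.gaussianOptimalCost Q N P =
      if 4 * N < Q ∧ P ∈ Set.Icc (Witsenhausen.P₁ Q N) (Witsenhausen.P₂ Q N) then
        N * (Q - N - P) / Q
      else Witsenhausen.linearCost Q N P := by
  have h := Witsenhausen.isLeast_gaussianCosts hQ hN hP
  have e : Witsenhausen.gaussianOptimalCost Q N P = _ := h.csInf_eq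
  exact ⟨e ▸ h.isGLB, e⟩
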